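/- Let $\mathfrak G_0$ be a compact semisimple real Lie algebra (finite dimensional, with negative definite Killing form) and $U$ a finite dimensional real $\mathfrak G_0$-module. Put $\mathfrak G=\mathfrak G_0^{\mathbb C}$, $V=U^{\mathbb C}$, let $J_0$ be the conjugation of $\mathfrak G$ determined by $\mathfrak G_0$, and let $\mathfrak H_0$ be a maximal abelian subalgebra of $\mathfrak G_0$, $\mathfrak H=\mathfrak H_0^{\mathbb C}$. Let $\Phi\subset\mathrm{Hom}(\mathfrak H,\mathbb C)$ be the roots, $B$ the Killing form of $\mathfrak G$, $H_\alpha\in\mathfrak H$ the vector with $B(H,H_\alpha)=\alpha(H)$ for all $H\in\mathfrak H$, and $\tau_\alpha=2H_\alpha/B(H_\alpha,H_\alpha)$. Let $W\subset GL(\mathfrak H)$ be the Weyl group, generated by the reflections $\sigma_\alpha(H)=H-\alpha(H)\tau_\alpha$; it acts on $\mathrm{Hom}(\mathfrak H,\mathbb C)$ by $\sigma(\mu)=\mu\circ\sigma^{-1}$. Choose $X_\alpha\in\mathfrak G_\alpha$ $(\alpha\in\Phi)$ with $[X_\alpha,X_{-\alpha}]=\tau_\alpha$ and $J_0(X_\alpha)=-X_{-\alpha}$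 (for example from a Chevalley basis of $\mathfrak G$ whose compact Chevalley basis spans $\mathfrak G_0$). For $\mu\in\mathrm{Hom}(\mathfrak H,\mathbb C)$ let $V_\mu=\{v\in V: Hv=\mu(H)v \text{ for all } H\in\mathfrak H\}$ and $U_\mu=(V_\mu+V_{-\mu})\cap U$. Give $\mathfrak N_0=U\oplus\mathfrak G_0$ the 2-step nilpotent bracket for which $\mathfrak G_0$ is central, $[\mathfrak N_0,\mathfrak N_0]\subseteq\mathfrak G_0$ and $\langle[u,u'],Z\rangle=\langle Zu,u'\rangle$ for $u,u'\in U$, $Z\in\mathfrak G_0$, where $\langle\ ,\ \rangle$ is an inner product with $U\perp\mathfrak G_0$ for which the elements of $\mathfrak G_0$ act on $U$ and (by $\mathrm{ad}$) on $\mathfrak G_0$ by skew symmetric maps. Give $\mathfrak N=V\oplus\mathfrak G$ in the same way the bracket with $\mathfrak G$ central, $[\mathfrak N,\mathfrak N]\subseteq\mathfrak G$ and $B^*([v,v'],Z)=B^*(Zv,v')$, where $B^*$ is a nondegenerate symmetric complex bilinear form with $V\perp\mathfrak G$ for which the elements of $\mathfrak G$ are skew symmetric on $V$ and on $\mathfrak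 G$ (for instance the complex bilinear extension of $\langle\ ,\ \rangle$, in which case $\mathfrak N=\mathfrak N_0^{\mathbb C}$). Every $\sigma\in W$ is a product $\sigma_{\alpha_1}\cdots\sigma_{\alpha_k}$ with $\alpha_i\in\Phi$. For any such expression put $T_\sigma=T_{\alpha_1}\cdots T_{\alpha_k}$ on $V$, where $T_\alpha=\exp(X_\alpha)\exp(-X_{-\alpha})\exp(X_\alpha)$, let $\varphi_\sigma$ be the operator on $\mathfrak G$ obtained in the same way from the adjoint representation, and let $\zeta_\sigma=T_\sigma\oplus\varphi_\sigma$ on $\mathfrak N$. Then: 1. $T_\sigma$ is invertible and $T_\sigma\circ H\circ T_\sigma^{-1}=\sigma(H)$ on $V$ for all $H\in\mathfrak H$; $\varphi_\sigma$ is an automorphism of the Lie algebra $\mathfrak G$ and $\varphi_\sigma(H)=\sigma(H)$ for all $H\in\mathfrak H$. 2. $T_\sigma(V_\mu)=V_{\sigma(\mu)}$ and $T_\sigma(U_\mu)=U_{\sigma(\mu)}$ for all $\mu\in\mathrm{Hom}(\mathfrak H,\mathbb C)$, in particular for $\mu=0$ and for every weight $\mu$ of $V$. 3. $\zeta_\sigma$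 is an automorphism of the Lie algebra $\mathfrak N$. It is unitary for every Hermitian inner product on $\mathfrak N$ for which the elements of $\mathfrak G_0$ (acting on $V$ and by $\mathrm{ad}$ on $\mathfrak G$) are skew Hermitian, and $T_\sigma$ is unitary for every Hermitian inner product on $V$ for which the elements of $\mathfrak G_0$ are skew Hermitian. 4. $\zeta_\sigma(\mathfrak N_0)=\mathfrak N_0$, and the restriction of $\zeta_\sigma$ to $\mathfrak N_0$ is an automorphism of the Lie algebra $\mathfrak N_0$. 5. The restriction of $\zeta_\sigma$ to $\mathfrak N_0$ is an isometry for every $\mathfrak G_0$-invariant inner product on $\mathfrak N_0$, that is, every inner product for which the elements of $\mathfrak G_0$ (acting on $U$ and by $\mathrm{ad}$ on $\mathfrak G_0$) are skew symmetric. -/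

import Mathlib

open scoped TensorProduct ComplexConjugate

noncomputable section

namespace WeylNil

/-! ### Two-step nilpotent Lie algebras attached to a module over a Lie algebra -/

section TwoStep

variable {K L V : Type*} [Field K] [LieRing L] [LieAlgebra K L]
  [AddCommGroup V] [Module K V] [LieRingModule L V] [LieModule K L V]

variable (K L V) in
/-- A nondegenerate symmetric bilinear form on `V ⊕ L` for which `V` and `L` are orthogonal and for
which the elements of `L` are skew symmetric both on `V` and on `L` (by the adjoint action). Such a
form is the orthogonal sum of its restrictions `formV` and `formL`. -/
structure InvForm where
  formV : LinearMap.BilinForm K V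
  formL : LinearMap.BilinForm K L
  symmV : ∀ v v', formV v v' = formV v' v
  symmL : ∀ y z, formL y z = formL z y
  nondegV : formV.Nondegenerate
  nondegL : formL.Nondegenerate
  skewV : ∀ (x : L) (v v' : V), formV ⁅x, v⁆ v' + formV v ⁅x, v'⁆ = 0
  skewL : ∀ x y z : L, formL ⁅x, y⁆ z + formL y ⁅x, z⁆ = 0

/-- The vector space `V ⊕ L`, to be equipped with the bracket determined by the form `B`. -/
def TwoStep (_B : InvForm K L V) : Type _ := V × L

namespace TwoStep

variable (B : InvForm K L V)

instance : AddCommGroup (TwoStep B) := inferInstanceAs (AddCommGroup (V × L))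
instance : Module K (TwoStep B) := inferInstanceAs (Module K (V × L))

/-- The identification of `V ⊕ L` with the underlying space of `TwoStep B`. -/
def mk : (V × L) ≃ₗ[K] TwoStep B := LinearEquiv.refl K (V × L)

/-- For `v, v'` in `V`, the linear functional `z ↦ B(z v, v')` on `L`. -/
def momentFun (v v' : V) : Module.Dual K L where
  toFun z := B.formV ⁅z, v⁆ v'
  map_add' z z' := by simp
  map_smul' c z := by simp

variable [FiniteDimensional K L]

/-- The element `[v, v']` of `L` with `B([v, v'], z) = B(z v, v')` for all `z` in `L`. -/
def moment (v v' : V) : L := (B.formL.toDual B.nondegL).symm (momentFun B v v')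

theorem formL_moment (v v' : V) (z : L) : B.formL (moment B v v') z = B.formV ⁅z, v⁆ v' := by
  have h := LinearEquiv.apply_symm_apply (B.formL.toDual B.nondegL) (momentFun B v v')
  exact congrArg (fun f : Module.Dual K L => f z) h

theorem moment_eq_iff (v v' : V) (y : L) :
    moment B v v' = y ↔ ∀ z, B.formL y z = B.formV ⁅z, v⁆ v' := by
  constructor
  · rintro rfl z
    exact formL_moment B v v' z
  · intro h
    unfold moment
    rw [LinearEquiv.symm_apply_eq]
    ext z
    exact (h z).symm

/-- The bracket of `V ⊕ L`: the summand `L` is central, the bracket takes values in `L`, and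
`B([v, v'], z) = B(z v, v')` for `v, v'` in `V` and `z` in `L`. -/
instance : Bracket (TwoStep B) (TwoStep B) where
  bracket p q := mk B (0, moment B ((mk B).symm p).1 ((mk B).symm q).1)

theorem bracket_mk (p q : V × L) : ⁅mk B p, mk B q⁆ = mk B (0, moment B p.1 q.1) := rfl

theorem moment_add_left (u v w : V) : moment B (u + v) w = moment B u w + moment B v w := by
  rw [moment_eq_iff]
  intro z
  simp [formL_moment]

theorem moment_add_right (u v w : V) : moment B u (v + w) = moment B u v + moment B u w := by
  rw [moment_eq_iff]
  intro z
  simp [formL_moment]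

theorem moment_smul_right (c : K) (u v : V) : moment B u (c • v) = c • moment B u v := by
  rw [moment_eq_iff]
  intro z
  simp [formL_moment]

theorem moment_self [CharZero K] (v : V) : moment B v v = 0 := by
  rw [moment_eq_iff]
  intro z
  have h := B.skewV z v v
  rw [B.symmV v ⁅z, v⁆, ← two_mul] at h
  have h2 : B.formV ⁅z, v⁆ v = 0 := (mul_eq_zero.mp h).resolve_left two_ne_zero
  simp [h2]

theorem moment_zero_left (v : V) : moment B 0 v = 0 := by
  rw [moment_eq_iff]
  intro z
  simp

theorem moment_zero_right (v : V) : moment B v 0 = 0 := by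
  rw [moment_eq_iff]
  intro z
  simp

instance [CharZero K] : LieRing (TwoStep B) where
  add_lie p q r := by
    change mk B (0, moment B (p.1 + q.1) r.1) =
      mk B (0, moment B p.1 r.1) + mk B (0, moment B q.1 r.1)
    rw [← map_add, moment_add_left, Prod.mk_add_mk, add_zero]
  lie_add p q r := by
    change mk B (0, moment B p.1 (q.1 + r.1)) =
      mk B (0, moment B p.1 q.1) + mk B (0, moment B p.1 r.1)
    rw [← map_add, moment_add_right, Prod.mk_add_mk, add_zero]
  lie_self p := by
    change mk B (0, moment B p.1 p.1) = 0
    rw [moment_self]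
    rfl
  leibniz_lie p q r := by
    change mk B (0, moment B p.1 0) =
      mk B (0, moment B 0 r.1) + mk B (0, moment B q.1 0)
    rw [← map_add, moment_zero_left, moment_zero_right, moment_zero_right, Prod.mk_add_mk,
      add_zero, add_zero]

instance [CharZero K] : LieAlgebra K (TwoStep B) where
  lie_smul c p q := by
    change mk B (0, moment B p.1 (c • q.1)) = c • mk B (0, moment B p.1 q.1)
    rw [← map_smul, moment_smul_right, Prod.smul_mk, smul_zero]

end TwoStep

/-- The action of `x : L` on `V ⊕ L`, by the module structure on `V` and by `ad x` on `L`. -/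
def diagAct (x : L) (p : V × L) : V × L := (⁅x, p.1⁆, ⁅x, p.2⁆)

end TwoStep

/-! ### Roots, weights and the Weyl group -/

section Roots

variable {K G M : Type*} [Field K] [LieRing G] [LieAlgebra K G]
  [AddCommGroup M] [Module K M] [LieRingModule G M] [LieModule K G M]

variable (M) in
/-- The weight space `M_μ = {m | h m = μ(h) m for all h in H}`. -/
def wtSpace (H : LieSubalgebra K G) (μ : Module.Dual K H) : Submodule K M where
  carrier := {m | ∀ h : H, ⁅(h : G), m⁆ = μ h • m}
  add_mem' {a b} ha hb h := by rw [lie_add, ha h, hb h, smul_add]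
  zero_mem' h := by simp
  smul_mem' c m hm h := by rw [lie_smul, hm h, smul_comm]

/-- The root space `G_α`, the weight space of the adjoint representation. -/
def rootSpace (H : LieSubalgebra K G) (α : Module.Dual K H) : Submodule K G := wtSpace G H α

/-- The roots of `G` with respect to `H`. -/
def roots (H : LieSubalgebra K G) : Set (Module.Dual K H) :=
  {α | α ≠ 0 ∧ rootSpace H α ≠ ⊥}

open Classical in
/-- The element `H_α` of `H` that represents `α` with respect to the Killing form of `G`. It exists
and is unique when the Killing form is nondegenerate on `H`; the value is `0` if there is none. -/
def rootVector (H : LieSubalgebra K G) (α : Module.Dual K H) : H :=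
  if e : ∃ t : H, ∀ h : H, killingForm K G (h : G) (t : G) = α h then e.choose else 0

/-- `τ_α = 2 H_α / B(H_α, H_α)`, with `B` the Killing form of `G`. -/
def coroot (H : LieSubalgebra K G) (α : Module.Dual K H) : H :=
  (2 / killingForm K G (rootVector H α : G) (rootVector H α : G)) • rootVector H α

/-- The Weyl reflection `h ↦ h - α(h) τ_α` of `H`. -/
def weylReflection (H : LieSubalgebra K G) (α : Module.Dual K H) : Module.End K H :=
  Module.preReflection (coroot H α) α

/-- The Weyl group, generated by the reflections in the roots. -/
def weylGroup (H : LieSubalgebra K G) : Subgroup (H ≃ₗ[K] H) :=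
  Subgroup.closure {s | ∃ α ∈ roots H, (s : H →ₗ[K] H) = weylReflection H α}

/-- The action of `σ` on linear functionals: `σ(μ)(h) = μ(σ⁻¹ h)`. -/
def dualAct {H : LieSubalgebra K G} (σ : H ≃ₗ[K] H) (μ : Module.Dual K H) : Module.Dual K H :=
  μ ∘ₗ (σ.symm : H →ₗ[K] H)

/-- `w = [α₁, …, αₖ]` is a list of roots such that `σ` is the product of the reflections in
`α₁, …, αₖ`, in this order. -/
def IsWord {H : LieSubalgebra K G} (w : List (Module.Dual K H)) (σ : H ≃ₗ[K] H) : Prop :=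
  (∀ α ∈ w, α ∈ roots H) ∧ (w.map (weylReflection H)).prod = (σ : H →ₗ[K] H)

end Roots

/-! ### Complexification of a compact semisimple Lie algebra and of its modules -/

section Complexification

variable {G₀ : Type*} [LieRing G₀] [LieAlgebra ℝ G₀]

/-- The complexification `H = H₀^ℂ` in `G = G₀^ℂ` of a subalgebra `H₀` of `G₀`. -/
def cplx (H₀ : LieSubalgebra ℝ G₀) : LieSubalgebra ℂ (ℂ ⊗[ℝ] G₀) :=
  { H₀.toSubmodule.baseChange ℂ with
    lie_mem' := by
      intro x y hx hy
      rw [Submodule.mem_carrier, SetLike.mem_coe, Submodule.baseChange_eq_span] at hx hy ⊢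
      refine Submodule.span_induction₂
        (p := fun x y _ _ => ⁅x, y⁆ ∈ Submodule.span ℂ
          (H₀.toSubmodule.map (TensorProduct.mk ℝ ℂ G₀ 1) : Set (ℂ ⊗[ℝ] G₀)))
        ?_ ?_ ?_ ?_ ?_ ?_ ?_ hx hy
      · rintro - - ⟨x, hx, rfl⟩ ⟨y, hy, rfl⟩
        exact Submodule.subset_span ⟨⁅x, y⁆, H₀.lie_mem hx hy, by simp⟩
      · intro y _
        rw [zero_lie]
        exact Submodule.zero_mem _
      · intro x _
        rw [show ⁅x, (0 : ℂ ⊗[ℝ] G₀)⁆ = 0 from lie_zero x]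
        exact Submodule.zero_mem _
      · intro x y z _ _ _ h h'
        rw [add_lie]
        exact Submodule.add_mem _ h h'
      · intro x y z _ _ _ h h'
        rw [show ⁅x, y + z⁆ = ⁅x, y⁆ + ⁅x, z⁆ from lie_add x y z]
        exact Submodule.add_mem _ h h'
      · intro r x y _ _ h
        rw [smul_lie]
        exact Submodule.smul_mem _ r h
      · intro r x y _ _ h
        rw [show ⁅x, r • y⁆ = r • ⁅x, y⁆ from lie_smul r x y]
        exact Submodule.smul_mem _ r h }

variable (G₀) in
/-- A compact semisimple real Lie algebra: the Killing form is negative definite. -/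
def IsCompactSemisimple : Prop := ∀ x : G₀, x ≠ 0 → killingForm ℝ G₀ x x < 0

/-- The conjugation of `M^ℂ` determined by the real form `M`. -/
def conjugation (M : Type*) [AddCommGroup M] [Module ℝ M] : (ℂ ⊗[ℝ] M) →ₗ[ℝ] (ℂ ⊗[ℝ] M) :=
  LinearMap.rTensor M (Complex.conjAe : ℂ →ₗ[ℝ] ℂ)

/-- The inclusion of `M` as a real form of `M^ℂ`. -/
def realIncl (M : Type*) [AddCommGroup M] [Module ℝ M] : M →ₗ[ℝ] (ℂ ⊗[ℝ] M) :=
  TensorProduct.mk ℝ ℂ M 1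

/-- `X` is a choice of root vectors `X_α` with `[X_α, X_{-α}] = τ_α` and `J₀(X_α) = -X_{-α}`, where
`J₀` is the conjugation of `G = G₀^ℂ` determined by `G₀`. Every Chevalley basis of `G` whose compact
Chevalley basis spans `G₀` is such a choice. Values of `X` outside the roots are irrelevant. -/
structure IsAdapted (H₀ : LieSubalgebra ℝ G₀)
    (X : Module.Dual ℂ (cplx H₀) → ℂ ⊗[ℝ] G₀) : Prop where
  mem : ∀ α ∈ roots (cplx H₀), X α ∈ rootSpace (cplx H₀) α
  lie_neg : ∀ α ∈ roots (cplx H₀),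
    ⁅X α, X (-α)⁆ = (coroot (cplx H₀) α : ℂ ⊗[ℝ] G₀)
  conjugation_eq : ∀ α ∈ roots (cplx H₀), conjugation G₀ (X α) = -X (-α)

variable (M : Type*) [AddCommGroup M] [Module ℝ M] [LieRingModule G₀ M] [LieModule ℝ G₀ M]

/-- The exponential of the action of `x ∈ G₀^ℂ` on `M^ℂ`, for `x` acting nilpotently (a finite
sum). -/
def expAct (x : ℂ ⊗[ℝ] G₀) : Module.End ℂ (ℂ ⊗[ℝ] M) :=
  IsNilpotent.exp (LieModule.toEnd ℂ (ℂ ⊗[ℝ] G₀) (ℂ ⊗[ℝ] M) x)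

variable {H₀ : LieSubalgebra ℝ G₀} (X : Module.Dual ℂ (cplx H₀) → ℂ ⊗[ℝ] G₀)

/-- `exp(X_α) exp(-X_{-α}) exp(X_α)` on `M^ℂ`. -/
def reflOp (α : Module.Dual ℂ (cplx H₀)) : Module.End ℂ (ℂ ⊗[ℝ] M) :=
  expAct M (X α) * expAct M (-X (-α)) * expAct M (X α)

/-- For `w = [α₁, …, αₖ]`, the composition of the operators `exp(X_α) exp(-X_{-α}) exp(X_α)` on
`M^ℂ` for `α = α₁, …, αₖ`. For `M = U` this is `T_σ`, and for `M = G₀` with the adjoint action it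
is `φ_σ`, where `σ` is the product of the reflections in `α₁, …, αₖ`. -/
def weylOp (w : List (Module.Dual ℂ (cplx H₀))) : Module.End ℂ (ℂ ⊗[ℝ] M) :=
  (w.map (reflOp M X)).prod

/-- The real weight space `M_μ = (V_μ ⊕ V_{-μ}) ∩ M`, where `V = M^ℂ`; for `μ = 0` it is
`V_0 ∩ M`. -/
def realWtSpace (μ : Module.Dual ℂ (cplx H₀)) : Submodule ℝ (ℂ ⊗[ℝ] M) :=
  (wtSpace (ℂ ⊗[ℝ] M) (cplx H₀) μ ⊔
    wtSpace (ℂ ⊗[ℝ] M) (cplx H₀) (-μ)).restrictScalars ℝ ⊓ LinearMap.range (realIncl M)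

/-- `ζ_σ` on `V ⊕ G`, with `V = M^ℂ` and `G = G₀^ℂ`: it is `T_σ` on `V` and `φ_σ` on `G`. -/
def zeta (w : List (Module.Dual ℂ (cplx H₀))) :
    Module.End ℂ ((ℂ ⊗[ℝ] M) × (ℂ ⊗[ℝ] G₀)) :=
  LinearMap.prodMap (weylOp M X w) (weylOp G₀ X w)

variable (G₀) in
/-- The inclusion of `M ⊕ G₀` as a real form of `V ⊕ G`. -/
def realInclN : (M × G₀) →ₗ[ℝ] ((ℂ ⊗[ℝ] M) × (ℂ ⊗[ℝ] G₀)) :=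
  LinearMap.prodMap (realIncl M) (realIncl G₀)

end Complexification

/-! ### Invariant inner products -/

section InnerProducts

/-- `b` is an inner product on the real space `P` for which all the maps `A x` are skew
symmetric. -/
structure IsInvInner {S P : Type*} [AddCommGroup P] [Module ℝ P] (A : S → P → P)
    (b : LinearMap.BilinForm ℝ P) : Prop where
  symm : ∀ p q, b p q = b q p
  pos : ∀ p, p ≠ 0 → 0 < b p p
  skew : ∀ x p q, b (A x p) q + b p (A x q) = 0

/-- `h` is a Hermitian inner product on the complex space `P` for which all the maps `A x` are skew
Hermitian. -/
structure IsInvHermitian {S P : Type*} [AddCommGroup P] [Module ℂ P] (A : S → P → P)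
    (h : P →ₗ⋆[ℂ] P →ₗ[ℂ] ℂ) : Prop where
  symm : ∀ p q, conj (h p q) = h q p
  pos : ∀ p, p ≠ 0 → 0 < (h p p).re
  skew : ∀ x p q, h (A x p) q + h p (A x q) = 0

end InnerProducts

section RealForm

open LinearMap (BilinForm)

/-- The complex bilinear extension of a positive definite real form is nondegenerate. -/
theorem baseChange_nondegenerate {P : Type*} [AddCommGroup P] [Module ℝ P] (b : BilinForm ℝ P)
    (hs : ∀ p q, b p q = b q p) (hp : ∀ p, p ≠ 0 → 0 < b p p) :
    (b.baseChange ℂ).Nondegenerate := by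
  have hrep : ∀ z : ℂ ⊗[ℝ] P, ∃ p q : P, z = (1 : ℂ) ⊗ₜ[ℝ] p + Complex.I ⊗ₜ[ℝ] q := by
    intro z
    induction z using TensorProduct.induction_on with
    | zero => exact ⟨0, 0, by simp⟩
    | tmul c p =>
      refine ⟨c.re • p, c.im • p, ?_⟩
      rw [← TensorProduct.smul_tmul, ← TensorProduct.smul_tmul, ← TensorProduct.add_tmul]
      congr 1
      apply Complex.ext <;> simp
    | add x y hx hy =>
      obtain ⟨p, q, rfl⟩ := hx
      obtain ⟨p', q', rfl⟩ := hy
      exact ⟨p + p', q + q', by simp only [TensorProduct.tmul_add]; abel⟩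
  have hsep : ∀ z : ℂ ⊗[ℝ] P, (∀ w, b.baseChange ℂ z w = 0) → z = 0 := by
    intro z hz
    obtain ⟨p, q, rfl⟩ := hrep z
    have key : ∀ r, b p r = 0 ∧ b q r = 0 := by
      intro r
      have h := hz ((1 : ℂ) ⊗ₜ[ℝ] r)
      simp only [map_add, LinearMap.add_apply, LinearMap.BilinForm.baseChange_tmul] at h
      have h1 := congrArg Complex.re h
      have h2 := congrArg Complex.im h
      simp at h1 h2
      exact ⟨h1, h2⟩
    have hp0 : p = 0 := by
      by_contra hne
      exact (hp p hne).ne' (key p).1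
    have hq0 : q = 0 := by
      by_contra hne
      exact (hp q hne).ne' (key q).2
    simp [hp0, hq0]
  have hsymm : ∀ z w, b.baseChange ℂ z w = b.baseChange ℂ w z :=
    (LinearMap.BilinForm.IsSymm.baseChange ℂ (B₂ := b) ⟨hs⟩).eq
  exact ⟨hsep, fun z hz => hsep z fun w => by rw [hsymm]; exact hz w⟩

variable {G₀ U : Type*} [LieRing G₀] [LieAlgebra ℝ G₀]
  [AddCommGroup U] [Module ℝ U] [LieRingModule G₀ U] [LieModule ℝ G₀ U]

/-- An inner product on `U ⊕ G₀` for which `U` and `G₀` are orthogonal and for which the elements of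
`G₀` are skew symmetric on `U` and on `G₀` is a form as above that is positive definite. -/
structure InvForm.IsPosDef (B₀ : InvForm ℝ G₀ U) : Prop where
  posV : ∀ u, u ≠ 0 → 0 < B₀.formV u u
  posL : ∀ y, y ≠ 0 → 0 < B₀.formL y y

/-- The complex bilinear extension to `V ⊕ G`, where `V = U^ℂ` and `G = G₀^ℂ`, of such an inner
product on `U ⊕ G₀`. -/
def InvForm.complexify (B₀ : InvForm ℝ G₀ U) (h : B₀.IsPosDef) :
    InvForm ℂ (ℂ ⊗[ℝ] G₀) (ℂ ⊗[ℝ] U) where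
  formV := B₀.formV.baseChange ℂ
  formL := B₀.formL.baseChange ℂ
  symmV := (LinearMap.BilinForm.IsSymm.baseChange ℂ (B₂ := B₀.formV) ⟨B₀.symmV⟩).eq
  symmL := (LinearMap.BilinForm.IsSymm.baseChange ℂ (B₂ := B₀.formL) ⟨B₀.symmL⟩).eq
  nondegV := baseChange_nondegenerate _ B₀.symmV h.posV
  nondegL := baseChange_nondegenerate _ B₀.symmL h.posL
  skewV x v v' := by
    induction x using TensorProduct.induction_on with
    | zero => simp
    | add x y hx hy =>
      simp only [add_lie, map_add, LinearMap.add_apply]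
      linear_combination hx + hy
    | tmul c x =>
      induction v using TensorProduct.induction_on with
      | zero => simp
      | add v w hv hw =>
        simp only [lie_add, map_add, LinearMap.add_apply]
        linear_combination hv + hw
      | tmul d v =>
        induction v' using TensorProduct.induction_on with
        | zero => simp
        | add v w hv hw =>
          simp only [lie_add, map_add]
          linear_combination hv + hw
        | tmul d' v' =>
          have e := B₀.skewV x v v'
          simp only [LieAlgebra.ExtendScalars.bracket_tmul, LinearMap.BilinForm.baseChange_tmul,
            eq_neg_of_add_eq_zero_left e, neg_smul]
          rw [show c * d * d' = d * (c * d') by ring, neg_add_cancel]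
  skewL x v v' := by
    induction x using TensorProduct.induction_on with
    | zero => simp
    | add x y hx hy =>
      simp only [add_lie, map_add, LinearMap.add_apply]
      linear_combination hx + hy
    | tmul c x =>
      induction v using TensorProduct.induction_on with
      | zero => simp
      | add v w hv hw =>
        simp only [lie_add, map_add, LinearMap.add_apply]
        linear_combination hv + hw
      | tmul d v =>
        induction v' using TensorProduct.induction_on with
        | zero => simp
        | add v w hv hw =>
          simp only [lie_add, map_add]
          linear_combination hv + hw
        | tmul d' v' =>
          have e := B₀.skewL x v v'
          simp only [LieAlgebra.ExtendScalars.bracket_tmul, LinearMap.BilinForm.baseChange_tmul,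
            eq_neg_of_add_eq_zero_left e, neg_smul]
          rw [show c * d * d' = d * (c * d') by ring, neg_add_cancel]

/-- `N₀ = U ⊕ G₀` is a real subalgebra of `N = V ⊕ G` for the bracket on `N` that is determined by
the complex bilinear extension of the inner product of `N₀`. -/
theorem lie_realInclN [FiniteDimensional ℝ G₀] (B₀ : InvForm ℝ G₀ U) (h : B₀.IsPosDef)
    (p q : U × G₀) :
    ⁅TwoStep.mk (B₀.complexify h) (realInclN G₀ U p),
      TwoStep.mk (B₀.complexify h) (realInclN G₀ U q)⁆ =
    TwoStep.mk (B₀.complexify h) (realInclN G₀ U ((TwoStep.mk B₀).symm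
      ⁅TwoStep.mk B₀ p, TwoStep.mk B₀ q⁆)) := by
  rw [TwoStep.bracket_mk, TwoStep.bracket_mk, LinearEquiv.symm_apply_apply]
  congr 1
  refine Prod.ext (map_zero (realIncl U)).symm ?_
  change TwoStep.moment _ (realIncl U p.1) (realIncl U q.1) =
    realIncl G₀ (TwoStep.moment B₀ p.1 q.1)
  rw [TwoStep.moment_eq_iff]
  intro z
  induction z using TensorProduct.induction_on with
  | zero => simp
  | add x y hx hy => simp only [map_add, add_lie, LinearMap.add_apply, hx, hy]
  | tmul c x =>
    simp [InvForm.complexify, realIncl, TwoStep.formL_moment]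

end RealForm

end WeylNil

end

/-! Everything is checked one root at a time. For a root `α` the vectors `τ_α`, `X_α`, `X_{-α}` form
an `sl₂`-triple `h, e, f`. This is where compactness enters: `ad` of an element of `H₀` is skew for
the negative definite Killing form, so `α` is imaginary on `H₀`. Hence `J₀` carries `G_α` to
`G_{-α}`, and `H_α` may be taken as `i t` with `t` nonzero in `H₀`, so that `α(H_α) = -B(t, t) ≠ 0`
and `α(τ_α) = 2`. Being eigenvectors of `ad h` with nonzero eigenvalue, `e` and `f` act nilpotently
on every finite dimensional module, and `T_α = exp(e) exp(-f) exp(e)` is a product of finite sums.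

An element `x` of `G` acts as a derivation of the action map `G × V → V`, so `exp(x)(y v) = (exp(ad
x) y)(exp(x) v)`. Therefore `T(y v) = φ(y) T(v)`, and `φ` is an automorphism of `G`. A computation
in the triple shows that `φ_α` is the reflection `σ_α` on `H`, which gives the permutation of the
weight spaces, and that `φ_α(e) = -f`. The second fact says `T_α exp(e) = exp(-f) T_α`; cancelling
`exp(e)` gives the braid relation `exp(e) exp(-f) exp(e) = exp(-f) exp(e) exp(-f)` (`slTwoOp_eq`).

The word for `T_α` is a palindrome, and changing the signs of `e` and `f` inverts it. If a pairing
makes `e` and `f` skew, the adjoint of `T_α` is thus its inverse. If it makes `e` and `f` adjoint to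
each other, as a Hermitian form does for which `G₀` is skew, the adjoint is `exp(f) exp(-e) exp(f)`,
which is the inverse by the braid relation. Conjugation exchanges `e` and `-f`, so by the braid
relation it commutes with `T_α`, and `T_σ`, `φ_σ` restrict to the real forms. Finally, the bracket
of `V ⊕ G` is determined by the form and the action, both of which `T_σ` and `φ_σ` preserve; the
same argument applies to `U ⊕ G₀`. -/

noncomputable section

namespace WeylNil

/-! ### Exponentials of nilpotent endomorphisms -/

section Exponential

variable {P Q R : Type*} [AddCommGroup P] [Module ℂ P] [AddCommGroup Q] [Module ℂ Q]
  [AddCommGroup R] [Module ℂ R]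

theorem exp_apply_eq_sum [Module ℚ (Module.End ℂ P)] {A : Module.End ℂ P} {k : ℕ}
    (hA : A ^ k = 0) (p : P) :
    IsNilpotent.exp A p = ∑ i ∈ Finset.range k, (i.factorial : ℂ)⁻¹ • (A ^ i) p := by
  rw [IsNilpotent.exp_eq_sum hA, LinearMap.sum_apply]
  refine Finset.sum_congr rfl fun i _ => ?_
  -- Whatever the `ℚ`-structure, `(i!)⁻¹` acts as the complex scalar does.
  exact map_inv_natCast_smul (LinearMap.applyₗ (R := ℂ) p : Module.End ℂ P →ₗ[ℂ] P) ℚ ℂ _ (A ^ i)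

/-- The exponential series may be truncated at a vector killed by a power. -/
theorem exp_apply_eq_sum_of_pow_apply [Module ℚ (Module.End ℂ P)] {A : Module.End ℂ P}
    (hA : IsNilpotent A) {k : ℕ} {p : P} (hp : (A ^ k) p = 0) :
    IsNilpotent.exp A p = ∑ i ∈ Finset.range k, (i.factorial : ℂ)⁻¹ • (A ^ i) p := by
  obtain ⟨l, hl⟩ := hA
  rw [exp_apply_eq_sum (pow_eq_zero_of_le (Nat.le_add_left l k) hl)]
  refine (Finset.sum_subset (Finset.range_mono (Nat.le_add_right k l)) fun i _ hi => ?_).symm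
  rw [Finset.mem_range, not_lt] at hi
  obtain ⟨j, rfl⟩ := Nat.exists_eq_add_of_le hi
  rw [add_comm k j, pow_add, Module.End.mul_apply, hp, map_zero, smul_zero]

/-- The coefficients of the series are inverses of natural numbers, which every additive map
respects. Linearity of `f` is not needed, so conjugations are covered as well. -/
theorem map_exp_apply [Module ℚ (Module.End ℂ P)] [Module ℚ (Module.End ℂ Q)]
    {A : Module.End ℂ P} {B : Module.End ℂ Q} (hA : IsNilpotent A) (hB : IsNilpotent B)
    (f : P →+ Q) (h : ∀ p, f (A p) = B (f p)) (p : P) :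
    f (IsNilpotent.exp A p) = IsNilpotent.exp B (f p) := by
  obtain ⟨k, hk⟩ := hA
  obtain ⟨l, hl⟩ := hB
  rw [exp_apply_eq_sum (pow_eq_zero_of_le (Nat.le_add_right k l) hk),
    exp_apply_eq_sum (pow_eq_zero_of_le (Nat.le_add_left l k) hl), map_sum]
  refine Finset.sum_congr rfl fun i _ => ?_
  rw [map_inv_natCast_smul f ℂ ℂ]
  congr 1
  clear * - h
  induction i with
  | zero => rfl
  | succ n ih => rw [pow_succ', pow_succ', Module.End.mul_apply, Module.End.mul_apply, h, ih]

/-- If `A` and `B` are adjoint for a biadditive pairing, then so are their exponentials. -/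
theorem pairing_exp_apply [Module ℚ (Module.End ℂ P)] [Module ℚ (Module.End ℂ Q)]
    {A : Module.End ℂ P} {B : Module.End ℂ Q} (hA : IsNilpotent A) (hB : IsNilpotent B)
    (b : P →+ Q →+ R) (h : ∀ p q, b (A p) q = b p (B q)) (p : P) (q : Q) :
    b (IsNilpotent.exp A p) q = b p (IsNilpotent.exp B q) := by
  obtain ⟨k, hk⟩ := hA
  obtain ⟨l, hl⟩ := hB
  rw [exp_apply_eq_sum (pow_eq_zero_of_le (Nat.le_add_right k l) hk),
    exp_apply_eq_sum (pow_eq_zero_of_le (Nat.le_add_left l k) hl), map_sum, map_sum,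
    AddMonoidHom.finsetSum_apply]
  refine Finset.sum_congr rfl fun i _ => ?_
  have h1 : b (((i.factorial : ℂ)⁻¹) • (A ^ i) p) q = ((i.factorial : ℂ)⁻¹) • b ((A ^ i) p) q :=
    map_inv_natCast_smul (b.flip q) ℂ ℂ _ _
  rw [h1, map_inv_natCast_smul (b p) ℂ ℂ]
  congr 1
  clear * - h
  induction i generalizing q with
  | zero => rfl
  | succ n ih =>
    rw [pow_succ', pow_succ, Module.End.mul_apply, Module.End.mul_apply, h, ih]

/-- The exponential of a derivation of a bilinear map is multiplicative. -/
theorem exp_apply_bilin [Module ℚ (Module.End ℂ P)] [Module ℚ (Module.End ℂ Q)]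
    [Module ℚ (Module.End ℂ R)] {A : Module.End ℂ P} {B : Module.End ℂ Q} {C : Module.End ℂ R}
    (hA : IsNilpotent A) (hB : IsNilpotent B) (hC : IsNilpotent C) (b : P →ₗ[ℂ] Q →ₗ[ℂ] R)
    (h : ∀ p q, C (b p q) = b (A p) q + b p (B q)) (p : P) (q : Q) :
    IsNilpotent.exp C (b p q) = b (IsNilpotent.exp A p) (IsNilpotent.exp B q) := by
  -- The comparison takes place on `P ⊗ Q`: there `A ⊗ 1` and `1 ⊗ B` are commuting nilpotents, the
  -- exponential of their sum is `exp A ⊗ exp B`, and the linear map induced by `b` intertwines that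
  -- sum with `C`.
  let _ : Module ℚ (Module.End ℂ (P ⊗[ℂ] Q)) := Module.compHom _ (algebraMap ℚ ℂ)
  let l : Module.End ℂ (P ⊗[ℂ] Q) := A.rTensor Q
  let r : Module.End ℂ (P ⊗[ℂ] Q) := B.lTensor P
  have hl : IsNilpotent l := hA.map (Module.End.rTensorAlgHom ℂ P Q)
  have hr : IsNilpotent r := hB.map (Module.End.lTensorAlgHom ℂ Q P)
  have hlr : Commute l r := by
    refine TensorProduct.ext' fun x y => ?_
    simp [l, r]
  have el : IsNilpotent.exp l = (IsNilpotent.exp A).rTensor Q :=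
    (hA.map_exp (Module.End.rTensorAlgHom ℂ P Q)).symm
  have er : IsNilpotent.exp r = (IsNilpotent.exp B).lTensor P :=
    (hB.map_exp (Module.End.lTensorAlgHom ℂ Q P)).symm
  have key := map_exp_apply (hlr.isNilpotent_add hl hr) hC
    (TensorProduct.lift b).toAddMonoidHom (fun z => by
      refine LinearMap.congr_fun (f := TensorProduct.lift b ∘ₗ (l + r))
        (g := C ∘ₗ TensorProduct.lift b) ?_ z
      refine TensorProduct.ext' fun x y => ?_
      simp [l, r, h]) (p ⊗ₜ q)
  rw [IsNilpotent.exp_add_of_commute hlr hl hr, el, er] at key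
  exact key.symm

/-- An eigenvector of `ad D` with nonzero eigenvalue is nilpotent. -/
theorem isNilpotent_of_commutator_eq_smul [FiniteDimensional ℂ P] {D A : Module.End ℂ P} {c : ℂ}
    (hc : c ≠ 0) (h : D * A - A * D = c • A) : IsNilpotent A := by
  by_contra hA
  have hpow : ∀ n : ℕ, D * A ^ n - A ^ n * D = (n * c) • A ^ n := by
    intro n
    induction n with
    | zero => simp
    | succ n ih =>
      have e : D * A ^ (n + 1) - A ^ (n + 1) * D =
          (D * A ^ n - A ^ n * D) * A + A ^ n * (D * A - A * D) := by
        rw [pow_succ]; noncomm_ring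
      rw [e, ih, h, smul_mul_assoc, mul_smul_comm, ← pow_succ, ← add_smul]
      congr 1
      push_cast
      ring
  -- If no power of `A` vanished, the powers would be eigenvectors of `ad D` for the infinitely many
  -- distinct eigenvalues `n c`.
  let F : Module.End ℂ (Module.End ℂ P) := LinearMap.mulLeft ℂ D - LinearMap.mulRight ℂ D
  have hev : ∀ n : ℕ, F.HasEigenvalue (n * c) := fun n =>
    Module.End.hasEigenvalue_of_hasEigenvector (x := A ^ n)
      ⟨Module.End.mem_eigenspace_iff.2 (hpow n), fun h0 => hA ⟨n, h0⟩⟩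
  refine Set.infinite_of_injective_forall_mem (f := fun n : ℕ => (n * c : ℂ)) ?_ hev
    F.finite_hasEigenvalue
  intro m n hmn
  exact_mod_cast mul_right_cancel₀ hc hmn

end Exponential

/-! ### The Weyl operator of an `sl₂`-triple -/

section SlTwo

/-! ### The adjoint action of an `sl₂`-triple -/

section Adjoint

variable {L : Type*} [LieRing L] {h e f : L}

/-- The pair `(-f, -e)` may replace `(e, f)`. This is the symmetry behind the braid relation, and it
turns formulas for `exp(e)` into formulas for `exp(-f)`. -/
theorem isSl2Triple_neg (t : IsSl2Triple h e f) : IsSl2Triple (-h) (-f) (-e) where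
  h_ne_zero := by simpa using t.h_ne_zero
  lie_e_f := by rw [neg_lie, lie_neg, neg_neg, ← lie_skew, t.lie_e_f]
  lie_h_e_nsmul := by rw [neg_lie, lie_neg, neg_neg, t.lie_h_f_nsmul, smul_neg]
  lie_h_f_nsmul := by rw [neg_lie, lie_neg, neg_neg, t.lie_h_e_nsmul, smul_neg, neg_neg]

theorem isSl2Triple_neg_neg (t : IsSl2Triple h e f) : IsSl2Triple h (-e) (-f) := by
  simpa using isSl2Triple_neg t.symm

variable [LieAlgebra ℂ L] [Module ℚ (Module.End ℂ L)]

/-- The exponential of `ad x` on `y` when `(ad x)³ y = 0`. -/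
theorem exp_ad_apply_of_lie_lie_lie {x y : L} (hx : IsNilpotent (LieModule.toEnd ℂ L L x))
    (hy : ⁅x, ⁅x, ⁅x, y⁆⁆⁆ = 0) :
    IsNilpotent.exp (LieModule.toEnd ℂ L L x) y =
      y + ⁅x, y⁆ + (2 : ℂ)⁻¹ • ⁅x, ⁅x, y⁆⁆ := by
  refine (exp_apply_eq_sum_of_pow_apply hx (k := 3) ?_).trans ?_
  · simpa [pow_succ] using hy
  · simp [Finset.sum_range_succ, pow_succ, Nat.factorial]

theorem exp_ad_e_f (t : IsSl2Triple h e f) (he : IsNilpotent (LieModule.toEnd ℂ L L e)) :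
    IsNilpotent.exp (LieModule.toEnd ℂ L L e) f = f + h - e := by
  have h1 : ⁅e, h⁆ = -((2 : ℂ) • e) := by rw [← lie_skew, t.lie_h_e_smul ℂ]
  rw [exp_ad_apply_of_lie_lie_lie he (by simp [t.lie_e_f, h1]), t.lie_e_f, h1]
  module

theorem exp_ad_apply_of_lie {x : L} {c : ℂ} (he : IsNilpotent (LieModule.toEnd ℂ L L e))
    (hx : ⁅x, e⁆ = c • e) :
    IsNilpotent.exp (LieModule.toEnd ℂ L L e) x = x - c • e := by
  have h1 : ⁅e, x⁆ = -(c • e) := by rw [← lie_skew, hx]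
  rw [exp_ad_apply_of_lie_lie_lie he (by simp [h1]), h1]
  simp [sub_eq_add_neg]

theorem exp_ad_neg_f_e (t : IsSl2Triple h e f)
    (hf : IsNilpotent (LieModule.toEnd ℂ L L f)) :
    IsNilpotent.exp (LieModule.toEnd ℂ L L (-f)) e = e + h - f := by
  have := exp_ad_e_f (isSl2Triple_neg t) (by rw [map_neg]; exact hf.neg)
  rw [map_neg (IsNilpotent.exp (LieModule.toEnd ℂ L L (-f)))] at this
  rw [← neg_inj, this]
  abel

/-- `exp(ad e) exp(-ad f) exp(ad e)` is a reflection on the elements that normalise `e` and `f`. -/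
theorem exp_ad_mul_of_lie (t : IsSl2Triple h e f) (he : IsNilpotent (LieModule.toEnd ℂ L L e))
    (hf : IsNilpotent (LieModule.toEnd ℂ L L f)) {x : L} {c : ℂ} (hxe : ⁅x, e⁆ = c • e)
    (hxf : ⁅x, f⁆ = -(c • f)) :
    (IsNilpotent.exp (LieModule.toEnd ℂ L L e) * IsNilpotent.exp (LieModule.toEnd ℂ L L (-f)) *
      IsNilpotent.exp (LieModule.toEnd ℂ L L e)) x = x - c • h := by
  have h1 : IsNilpotent.exp (LieModule.toEnd ℂ L L (-f)) x = x - c • f := by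
    rw [exp_ad_apply_of_lie (c := -c) (by rw [map_neg]; exact hf.neg)
      (by rw [lie_neg, hxf, neg_smul_neg, neg_neg])]
    module
  -- The three factors carry `x` to `x - c e`, then to `x - c e - c h`, then to `x - c h`.
  simp only [Module.End.mul_apply, exp_ad_apply_of_lie he hxe, map_sub, map_add, map_smul, h1,
    exp_ad_neg_f_e t hf, exp_ad_e_f t he, exp_ad_apply_of_lie (x := e) (c := 0) he (by simp),
    exp_ad_apply_of_lie he (t.lie_h_e_smul ℂ)]
  module

/-- The three factors carry `e` to `e`, then to `e + h - f`, then to `-f`. This value is the source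
of the braid relation. -/
theorem exp_ad_mul_e (t : IsSl2Triple h e f) (he : IsNilpotent (LieModule.toEnd ℂ L L e))
    (hf : IsNilpotent (LieModule.toEnd ℂ L L f)) :
    (IsNilpotent.exp (LieModule.toEnd ℂ L L e) * IsNilpotent.exp (LieModule.toEnd ℂ L L (-f)) *
      IsNilpotent.exp (LieModule.toEnd ℂ L L e)) e = -f := by
  simp only [Module.End.mul_apply, map_sub, map_add, map_smul, exp_ad_neg_f_e t hf,
    exp_ad_e_f t he, exp_ad_apply_of_lie (x := e) (c := 0) he (by simp),
    exp_ad_apply_of_lie he (t.lie_h_e_smul ℂ)]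
  module

end Adjoint

/-! ### Exponentials and Weyl operators on complexified modules -/

variable {G₀ M N : Type*} [LieRing G₀] [LieAlgebra ℝ G₀]
  [AddCommGroup M] [Module ℝ M] [LieRingModule G₀ M] [LieModule ℝ G₀ M]
  [AddCommGroup N] [Module ℝ N] [LieRingModule G₀ N] [LieModule ℝ G₀ N]

variable (M) in
theorem isNilpotent_toEnd_of_lie_eq_smul [FiniteDimensional ℝ M] {h x : ℂ ⊗[ℝ] G₀} {c : ℂ}
    (hc : c ≠ 0) (hx : ⁅h, x⁆ = c • x) :
    IsNilpotent (LieModule.toEnd ℂ (ℂ ⊗[ℝ] G₀) (ℂ ⊗[ℝ] M) x) := by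
  refine isNilpotent_of_commutator_eq_smul (D := LieModule.toEnd ℂ (ℂ ⊗[ℝ] G₀) (ℂ ⊗[ℝ] M) h) hc ?_
  refine LinearMap.ext fun m => ?_
  change ⁅h, ⁅x, m⁆⁆ - ⁅x, ⁅h, m⁆⁆ = c • ⁅x, m⁆
  exact (lie_lie h x m).symm.trans ((congrArg (fun y => ⁅y, m⁆) hx).trans (smul_lie c x m))

/-- The Leibniz identity says that `x` is a derivation of the bilinear action map, so
`exp_apply_bilin` applies. -/
theorem expAct_lie {x : ℂ ⊗[ℝ] G₀} (hG : IsNilpotent (LieModule.toEnd ℂ (ℂ ⊗[ℝ] G₀) (ℂ ⊗[ℝ] G₀) x))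
    (hM : IsNilpotent (LieModule.toEnd ℂ (ℂ ⊗[ℝ] G₀) (ℂ ⊗[ℝ] M) x)) (y : ℂ ⊗[ℝ] G₀) (m : ℂ ⊗[ℝ] M) :
    expAct M x ⁅y, m⁆ = ⁅expAct G₀ x y, expAct M x m⁆ :=
  exp_apply_bilin hG hM hM
    (LieModule.toEnd ℂ (ℂ ⊗[ℝ] G₀) (ℂ ⊗[ℝ] M) : (ℂ ⊗[ℝ] G₀) →ₗ[ℂ] Module.End ℂ (ℂ ⊗[ℝ] M))
    (fun y m => leibniz_lie x y m) y m

variable (M) in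
/-- The operator `exp(e) exp(-f) exp(e)` on `M^ℂ`. -/
def slTwoOp (e f : ℂ ⊗[ℝ] G₀) : Module.End ℂ (ℂ ⊗[ℝ] M) :=
  expAct M e * expAct M (-f) * expAct M e

variable {h e f : ℂ ⊗[ℝ] G₀}

theorem isNilpotent_toEnd_neg {x : ℂ ⊗[ℝ] G₀}
    (hM : IsNilpotent (LieModule.toEnd ℂ (ℂ ⊗[ℝ] G₀) (ℂ ⊗[ℝ] M) x)) :
    IsNilpotent (LieModule.toEnd ℂ (ℂ ⊗[ℝ] G₀) (ℂ ⊗[ℝ] M) (-x)) := by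
  rw [map_neg]
  exact hM.neg

theorem toEnd_neg_apply (x : ℂ ⊗[ℝ] G₀) (m : ℂ ⊗[ℝ] M) :
    LieModule.toEnd ℂ (ℂ ⊗[ℝ] G₀) (ℂ ⊗[ℝ] M) (-x) m = -⁅x, m⁆ :=
  neg_lie x m

theorem expAct_mul_expAct_neg {x : ℂ ⊗[ℝ] G₀}
    (hM : IsNilpotent (LieModule.toEnd ℂ (ℂ ⊗[ℝ] G₀) (ℂ ⊗[ℝ] M) x)) :
    expAct M x * expAct M (-x) = 1 := by
  unfold expAct
  rw [map_neg]
  exact IsNilpotent.exp_mul_exp_neg_self hM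

theorem expAct_neg_mul_expAct {x : ℂ ⊗[ℝ] G₀}
    (hM : IsNilpotent (LieModule.toEnd ℂ (ℂ ⊗[ℝ] G₀) (ℂ ⊗[ℝ] M) x)) :
    expAct M (-x) * expAct M x = 1 := by
  unfold expAct
  rw [map_neg]
  exact IsNilpotent.exp_neg_mul_exp_self hM

section Triple

variable (M) in
theorem isNilpotent_toEnd_e [FiniteDimensional ℝ M] (t : IsSl2Triple h e f) :
    IsNilpotent (LieModule.toEnd ℂ (ℂ ⊗[ℝ] G₀) (ℂ ⊗[ℝ] M) e) :=
  isNilpotent_toEnd_of_lie_eq_smul M two_ne_zero (t.lie_h_e_smul ℂ)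

variable (M) in
theorem isNilpotent_toEnd_f [FiniteDimensional ℝ M] (t : IsSl2Triple h e f) :
    IsNilpotent (LieModule.toEnd ℂ (ℂ ⊗[ℝ] G₀) (ℂ ⊗[ℝ] M) f) :=
  isNilpotent_toEnd_e M t.symm

variable [FiniteDimensional ℝ G₀]

theorem slTwoOp_lie [FiniteDimensional ℝ M] (t : IsSl2Triple h e f) (y : ℂ ⊗[ℝ] G₀) (m : ℂ ⊗[ℝ] M) :
    slTwoOp M e f ⁅y, m⁆ = ⁅slTwoOp G₀ e f y, slTwoOp M e f m⁆ := by
  have hG := isNilpotent_toEnd_e G₀ t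
  have hM := isNilpotent_toEnd_e M t
  have hG' := isNilpotent_toEnd_neg (isNilpotent_toEnd_f G₀ t)
  have hM' := isNilpotent_toEnd_neg (isNilpotent_toEnd_f M t)
  simp only [slTwoOp, Module.End.mul_apply, expAct_lie hG hM, expAct_lie hG' hM']

theorem slTwoOp_of_lie (t : IsSl2Triple h e f) {x : ℂ ⊗[ℝ] G₀} {c : ℂ} (hxe : ⁅x, e⁆ = c • e)
    (hxf : ⁅x, f⁆ = -(c • f)) : slTwoOp G₀ e f x = x - c • h :=
  exp_ad_mul_of_lie t (isNilpotent_toEnd_e G₀ t) (isNilpotent_toEnd_f G₀ t) hxe hxf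

theorem slTwoOp_e (t : IsSl2Triple h e f) : slTwoOp G₀ e f e = -f :=
  exp_ad_mul_e t (isNilpotent_toEnd_e G₀ t) (isNilpotent_toEnd_f G₀ t)

variable [FiniteDimensional ℝ M] [FiniteDimensional ℝ N]

/-- The relation `exp(e) exp(-f) exp(e) = exp(-f) exp(e) exp(-f)`. -/
theorem slTwoOp_eq (t : IsSl2Triple h e f) :
    slTwoOp M e f = expAct M (-f) * expAct M e * expAct M (-f) := by
  have he := isNilpotent_toEnd_e M t
  have hf := isNilpotent_toEnd_neg (isNilpotent_toEnd_f M t)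
  -- The operator sends `e` to `-f` in the adjoint representation, so on `M^ℂ` it intertwines the
  -- actions of `e` and `-f`, and hence their exponentials.
  have key : slTwoOp M e f * expAct M e = expAct M (-f) * slTwoOp M e f := by
    refine LinearMap.ext fun m => ?_
    refine map_exp_apply he hf (slTwoOp M e f).toAddMonoidHom (fun p => ?_) m
    have := slTwoOp_lie (M := M) t e p
    rwa [slTwoOp_e t] at this
  calc slTwoOp M e f = slTwoOp M e f * (expAct M e * expAct M (-e)) := by
        rw [expAct_mul_expAct_neg he, mul_one]
    _ = expAct M (-f) * (expAct M e * expAct M (-f) * expAct M e) * expAct M (-e) := by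
        rw [← mul_assoc, key, slTwoOp]
    _ = expAct M (-f) * expAct M e * expAct M (-f) * (expAct M e * expAct M (-e)) := by
        simp only [mul_assoc]
    _ = _ := by rw [expAct_mul_expAct_neg he, mul_one]

/-- The braid relation, read as invariance under the symmetry `(e, f) ↦ (-f, -e)`. -/
theorem slTwoOp_eq_neg (t : IsSl2Triple h e f) : slTwoOp M e f = slTwoOp M (-f) (-e) := by
  rw [slTwoOp_eq t, slTwoOp, neg_neg]

/-- The word is a palindrome, so a change of signs turns each factor into the inverse of its mirror
image. -/
theorem slTwoOp_mul_neg (t : IsSl2Triple h e f) :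
    slTwoOp M e f * slTwoOp M (-e) (-f) = 1 := by
  have he := expAct_mul_expAct_neg (isNilpotent_toEnd_e M t)
  have hf := expAct_neg_mul_expAct (isNilpotent_toEnd_f M t)
  calc slTwoOp M e f * slTwoOp M (-e) (-f) =
      expAct M e * (expAct M (-f) * (expAct M e * expAct M (-e)) * expAct M f) *
        expAct M (-e) := by simp only [slTwoOp, neg_neg, mul_assoc]
    _ = 1 := by rw [he, mul_one, hf, mul_one, he]

theorem slTwoOp_neg_mul (t : IsSl2Triple h e f) :
    slTwoOp M (-e) (-f) * slTwoOp M e f = 1 := by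
  have := slTwoOp_mul_neg (M := M) (isSl2Triple_neg_neg t)
  rwa [neg_neg, neg_neg] at this

/-- An additive map that exchanges the actions of `e` and `-f` commutes with the Weyl operators. -/
theorem map_slTwoOp (t : IsSl2Triple h e f) (j : (ℂ ⊗[ℝ] M) →+ (ℂ ⊗[ℝ] N))
    (he : ∀ m, j ⁅e, m⁆ = ⁅-f, j m⁆) (hf : ∀ m, j ⁅-f, m⁆ = ⁅e, j m⁆) (m : ℂ ⊗[ℝ] M) :
    j (slTwoOp M e f m) = slTwoOp N e f (j m) := by
  have h1 : ∀ m, j (expAct M e m) = expAct N (-f) (j m) :=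
    map_exp_apply (isNilpotent_toEnd_e M t) (isNilpotent_toEnd_neg (isNilpotent_toEnd_f N t)) j he
  have h2 : ∀ m, j (expAct M (-f) m) = expAct N e (j m) :=
    map_exp_apply (isNilpotent_toEnd_neg (isNilpotent_toEnd_f M t)) (isNilpotent_toEnd_e N t) j hf
  rw [slTwoOp_eq (M := N) t]
  simp only [slTwoOp, Module.End.mul_apply, h1, h2]

/-- The Weyl operators preserve every pairing for which `e` and `f` are skew. -/
theorem pairing_slTwoOp_of_skew {R : Type*} [AddCommGroup R] [Module ℂ R]
    (t : IsSl2Triple h e f) (b : (ℂ ⊗[ℝ] M) →+ (ℂ ⊗[ℝ] N) →+ R)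
    (he : ∀ m n, b ⁅e, m⁆ n = -(b m ⁅e, n⁆)) (hf : ∀ m n, b ⁅f, m⁆ n = -(b m ⁅f, n⁆))
    (m : ℂ ⊗[ℝ] M) (n : ℂ ⊗[ℝ] N) :
    b (slTwoOp M e f m) (slTwoOp N e f n) = b m n := by
  have h1 : ∀ m n, b (expAct M e m) n = b m (expAct N (-e) n) :=
    pairing_exp_apply (isNilpotent_toEnd_e M t)
      (isNilpotent_toEnd_neg (isNilpotent_toEnd_e N t)) b fun m n => by
        rw [toEnd_neg_apply, map_neg]
        exact he m n
  have h2 : ∀ m n, b (expAct M (-f) m) n = b m (expAct N f n) :=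
    pairing_exp_apply (isNilpotent_toEnd_neg (isNilpotent_toEnd_f M t))
      (isNilpotent_toEnd_f N t) b fun m n => by
        rw [toEnd_neg_apply, map_neg, AddMonoidHom.neg_apply, neg_eq_iff_eq_neg]
        exact hf m n
  -- Crossing the pairing reverses the order of the factors, which does not change a palindrome, and
  -- changes the signs of `e` and `f`.
  have h3 : b (slTwoOp M e f m) (slTwoOp N e f n) =
      b m (slTwoOp N (-e) (-f) (slTwoOp N e f n)) := by
    simp only [slTwoOp, Module.End.mul_apply, h1, h2, neg_neg]
  rw [h3, ← Module.End.mul_apply, slTwoOp_neg_mul t, Module.End.one_apply]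

/-- The Weyl operators preserve every pairing for which `e` and `f` are adjoint. -/
theorem pairing_slTwoOp_of_adjoint {R : Type*} [AddCommGroup R] [Module ℂ R]
    (t : IsSl2Triple h e f) (b : (ℂ ⊗[ℝ] M) →+ (ℂ ⊗[ℝ] N) →+ R)
    (he : ∀ m n, b ⁅e, m⁆ n = b m ⁅f, n⁆) (hf : ∀ m n, b ⁅f, m⁆ n = b m ⁅e, n⁆)
    (m : ℂ ⊗[ℝ] M) (n : ℂ ⊗[ℝ] N) :
    b (slTwoOp M e f m) (slTwoOp N e f n) = b m n := by
  have h1 : ∀ m n, b (expAct M e m) n = b m (expAct N f n) :=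
    pairing_exp_apply (isNilpotent_toEnd_e M t) (isNilpotent_toEnd_f N t) b he
  have h2 : ∀ m n, b (expAct M (-f) m) n = b m (expAct N (-e) n) :=
    pairing_exp_apply (isNilpotent_toEnd_neg (isNilpotent_toEnd_f M t))
      (isNilpotent_toEnd_neg (isNilpotent_toEnd_e N t)) b fun m n => by
        rw [toEnd_neg_apply, toEnd_neg_apply, map_neg, map_neg, AddMonoidHom.neg_apply, neg_inj]
        exact hf m n
  -- Crossing the pairing turns the word `e, -f, e` into `f, -e, f`. This inverts `-f, e, -f`, the
  -- other form of the operator on `N^ℂ`.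
  have h3 : b (slTwoOp M e f m) (slTwoOp N e f n) =
      b m (slTwoOp N (-(-f)) (-(-e)) (slTwoOp N (-f) (-e) n)) := by
    rw [slTwoOp_eq_neg (M := N) t, neg_neg, neg_neg]
    simp only [slTwoOp, Module.End.mul_apply, h1, h2]
  rw [h3, ← Module.End.mul_apply, slTwoOp_neg_mul (isSl2Triple_neg t), Module.End.one_apply]

end Triple

end SlTwo

/-! ### Conjugation and real points -/

section Conjugation

variable {G₀ M : Type*} [LieRing G₀] [LieAlgebra ℝ G₀]
  [AddCommGroup M] [Module ℝ M] [LieRingModule G₀ M] [LieModule ℝ G₀ M]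

theorem exists_eq_tmul_add_tmul (z : ℂ ⊗[ℝ] M) :
    ∃ p q : M, z = (1 : ℂ) ⊗ₜ[ℝ] p + Complex.I ⊗ₜ[ℝ] q := by
  induction z using TensorProduct.induction_on with
  | zero => exact ⟨0, 0, by simp⟩
  | tmul c p =>
    refine ⟨c.re • p, c.im • p, ?_⟩
    rw [← TensorProduct.smul_tmul, ← TensorProduct.smul_tmul, ← TensorProduct.add_tmul]
    congr 1
    apply Complex.ext <;> simp
  | add x y hx hy =>
    obtain ⟨p, q, rfl⟩ := hx
    obtain ⟨p', q', rfl⟩ := hy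
    exact ⟨p + p', q + q', by simp only [TensorProduct.tmul_add]; abel⟩

variable (M) in
/-- The projection of `M^ℂ` to its real form along `i M`. -/
def realPart : (ℂ ⊗[ℝ] M) →ₗ[ℝ] M :=
  TensorProduct.lid ℝ M ∘ₗ LinearMap.rTensor M Complex.reLm

theorem realPart_tmul (c : ℂ) (m : M) : realPart M (c ⊗ₜ m) = c.re • m := rfl

theorem realPart_realIncl (m : M) : realPart M (realIncl M m) = m := by
  rw [realIncl, TensorProduct.mk_apply, realPart_tmul, Complex.one_re, one_smul]

theorem realIncl_injective : Function.Injective (realIncl M) :=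
  Function.LeftInverse.injective realPart_realIncl

theorem conjugation_tmul (c : ℂ) (m : M) : conjugation M (c ⊗ₜ m) = conj c ⊗ₜ m := rfl

theorem conjugation_realIncl (m : M) : conjugation M (realIncl M m) = realIncl M m := by
  rw [realIncl, TensorProduct.mk_apply, conjugation_tmul, map_one]

theorem realIncl_realPart {z : ℂ ⊗[ℝ] M} (hz : conjugation M z = z) :
    realIncl M (realPart M z) = z := by
  have key : ∀ w : ℂ ⊗[ℝ] M, (2 : ℝ) • realIncl M (realPart M w) = w + conjugation M w := by
    intro w
    induction w using TensorProduct.induction_on with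
    | zero => simp
    | tmul c m =>
      rw [realPart_tmul, conjugation_tmul, ← TensorProduct.add_tmul, Complex.add_conj, realIncl,
        TensorProduct.mk_apply, ← TensorProduct.smul_tmul, TensorProduct.smul_tmul']
      congr 1
      apply Complex.ext <;> simp
    | add x y hx hy => rw [map_add, map_add, smul_add, hx, hy, map_add]; abel
  have h2 := key z
  rw [hz, ← two_smul ℝ z] at h2
  exact smul_right_injective _ (two_ne_zero' ℝ) h2

theorem conjugation_smul (c : ℂ) (z : ℂ ⊗[ℝ] M) :
    conjugation M (c • z) = conj c • conjugation M z := by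
  induction z using TensorProduct.induction_on with
  | zero => simp
  | tmul d m => simp only [TensorProduct.smul_tmul', conjugation_tmul, smul_eq_mul, map_mul]
  | add x y hx hy => rw [smul_add, map_add, hx, hy, map_add, smul_add]

theorem cplx_lie_zero (x : ℂ ⊗[ℝ] G₀) : ⁅x, (0 : ℂ ⊗[ℝ] M)⁆ = 0 :=
  lie_zero x

theorem cplx_lie_add (x : ℂ ⊗[ℝ] G₀) (v w : ℂ ⊗[ℝ] M) : ⁅x, v + w⁆ = ⁅x, v⁆ + ⁅x, w⁆ :=
  lie_add x v w

theorem conjugation_lie (x : ℂ ⊗[ℝ] G₀) (z : ℂ ⊗[ℝ] M) :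
    conjugation M ⁅x, z⁆ = ⁅conjugation G₀ x, conjugation M z⁆ := by
  induction x using TensorProduct.induction_on with
  | zero => simp
  | add x y hx hy => rw [add_lie, map_add, hx, hy, map_add, add_lie]
  | tmul c x =>
    induction z using TensorProduct.induction_on with
    | zero => rw [cplx_lie_zero, map_zero, cplx_lie_zero]
    | add v w hv hw => rw [cplx_lie_add, map_add, hv, hw, map_add, cplx_lie_add]
    | tmul d m =>
      simp only [conjugation_tmul, LieAlgebra.ExtendScalars.bracket_tmul, map_mul]

end Conjugation

/-! ### Roots of a compact semisimple Lie algebra -/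

section CompactRoots

variable {G₀ M : Type*} [LieRing G₀] [LieAlgebra ℝ G₀]
  [AddCommGroup M] [Module ℝ M] [LieRingModule G₀ M] [LieModule ℝ G₀ M]
  {H₀ : LieSubalgebra ℝ G₀}

variable (H₀) in
/-- The inclusion of `H₀` in its complexification. -/
def cplxIncl : H₀ →ₗ[ℝ] cplx H₀ where
  toFun h := ⟨(1 : ℂ) ⊗ₜ (h : G₀), Submodule.tmul_mem_baseChange_of_mem 1 h.2⟩
  map_add' h h' := Subtype.ext (by simp [TensorProduct.tmul_add])
  map_smul' c h := Subtype.ext (by simp)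

theorem coe_cplxIncl (h : H₀) : (cplxIncl H₀ h : ℂ ⊗[ℝ] G₀) = (1 : ℂ) ⊗ₜ (h : G₀) := rfl

/-- Complex linear conditions on `H₀^ℂ` may be tested on `H₀`. -/
theorem linearMap_ext_cplx {P : Type*} [AddCommGroup P] [Module ℂ P] {f g : cplx H₀ →ₗ[ℂ] P}
    (hfg : ∀ h, f (cplxIncl H₀ h) = g (cplxIncl H₀ h)) : f = g := by
  refine LinearMap.ext fun x => ?_
  obtain ⟨x, hx⟩ := x
  have hx' : x ∈ Submodule.span ℂ
      (H₀.toSubmodule.map (TensorProduct.mk ℝ ℂ G₀ 1) : Set (ℂ ⊗[ℝ] G₀)) := by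
    rw [← Submodule.baseChange_eq_span]; exact hx
  have hle : Submodule.span ℂ
      (H₀.toSubmodule.map (TensorProduct.mk ℝ ℂ G₀ 1) : Set (ℂ ⊗[ℝ] G₀)) ≤
      (LinearMap.eqLocus f g).map (cplx H₀).toSubmodule.subtype := by
    rw [Submodule.span_le]
    rintro - ⟨h, hh, rfl⟩
    exact ⟨cplxIncl H₀ ⟨h, hh⟩, hfg ⟨h, hh⟩, rfl⟩
  obtain ⟨y, hy, hyx⟩ := hle hx'
  have : y = ⟨x, hx⟩ := Subtype.ext hyx
  rw [← this]
  exact hy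

/-- Conjugation fixes the elements of `H₀`, so weight conditions tested there can be conjugated. -/
theorem mem_wtSpace_cplx {μ : Module.Dual ℂ (cplx H₀)} {v : ℂ ⊗[ℝ] M} :
    v ∈ wtSpace (ℂ ⊗[ℝ] M) (cplx H₀) μ ↔
      ∀ h, ⁅(cplxIncl H₀ h : ℂ ⊗[ℝ] G₀), v⁆ = μ (cplxIncl H₀ h) • v := by
  refine ⟨fun hv h => hv _, fun hv h => ?_⟩
  let F : cplx H₀ →ₗ[ℂ] (ℂ ⊗[ℝ] M) :=
    ((LieModule.toEnd ℂ (ℂ ⊗[ℝ] G₀) (ℂ ⊗[ℝ] M) : (ℂ ⊗[ℝ] G₀) →ₗ[ℂ] Module.End ℂ (ℂ ⊗[ℝ] M)).flip v) ∘ₗ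
      (cplx H₀).toSubmodule.subtype
  exact LinearMap.congr_fun (linearMap_ext_cplx (f := F) (g := μ.smulRight v) hv) h

theorem killingForm_lie_self (x y : G₀) : killingForm ℝ G₀ ⁅x, y⁆ y = 0 := by
  have h := LieModule.traceForm_apply_lie_apply ℝ G₀ G₀ x y y
  rwa [lie_self, map_zero] at h

/-- This follows from the condition at `α` because conjugation is an involution; it need not be
known that `-α` is a root. -/
theorem conjugation_neg {X : Module.Dual ℂ (cplx H₀) → ℂ ⊗[ℝ] G₀} (hX : IsAdapted H₀ X)
    {α : Module.Dual ℂ (cplx H₀)} (hα : α ∈ roots (cplx H₀)) :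
    conjugation G₀ (X (-α)) = -X α := by
  have hinv : ∀ z : ℂ ⊗[ℝ] G₀, conjugation G₀ (conjugation G₀ z) = z := by
    intro z
    induction z using TensorProduct.induction_on with
    | zero => simp
    | tmul c m => rw [conjugation_tmul, conjugation_tmul, Complex.conj_conj]
    | add x y hx hy => rw [map_add, map_add, hx, hy]
  rw [← hinv (X α), hX.conjugation_eq α hα, map_neg, neg_neg]

variable [FiniteDimensional ℝ G₀]

theorem killingForm_baseChange :
    killingForm ℂ (ℂ ⊗[ℝ] G₀) = (killingForm ℝ G₀).baseChange ℂ :=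
  LieModule.traceForm_baseChange ℝ G₀ G₀ ℂ

/-- Roots take imaginary values on `H₀`. -/
theorem root_re_eq_zero (hG₀ : IsCompactSemisimple G₀) {α : Module.Dual ℂ (cplx H₀)}
    (hα : α ∈ roots (cplx H₀)) (h : H₀) : (α (cplxIncl H₀ h)).re = 0 := by
  obtain ⟨v, hv, hv0⟩ := Submodule.exists_mem_ne_zero_of_ne_bot hα.2
  obtain ⟨p, q, rfl⟩ := exists_eq_tmul_add_tmul v
  have e : ⁅(cplxIncl H₀ h : ℂ ⊗[ℝ] G₀), (1 : ℂ) ⊗ₜ[ℝ] p + Complex.I ⊗ₜ[ℝ] q⁆ =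
      α (cplxIncl H₀ h) • ((1 : ℂ) ⊗ₜ[ℝ] p + Complex.I ⊗ₜ[ℝ] q) := hv _
  generalize α (cplxIncl H₀ h) = c at e ⊢
  have e' : (1 : ℂ) ⊗ₜ[ℝ] ⁅(h : G₀), p⁆ + Complex.I ⊗ₜ[ℝ] ⁅(h : G₀), q⁆ =
      c ⊗ₜ[ℝ] p + (c * Complex.I) ⊗ₜ[ℝ] q := by
    rw [coe_cplxIncl, cplx_lie_add] at e
    refine Eq.trans ?_ (e.trans ?_)
    · simp only [LieAlgebra.ExtendScalars.bracket_tmul, one_mul]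
    · simp only [smul_add, TensorProduct.smul_tmul', smul_eq_mul, mul_one]
  have e1 := congrArg (realPart G₀) e'
  have e2 := congrArg (fun z => realPart G₀ (-Complex.I • z)) e'
  simp only [map_add, smul_add, TensorProduct.smul_tmul', realPart_tmul, smul_eq_mul] at e1 e2
  simp at e1 e2
  have k1 := killingForm_lie_self (h : G₀) p
  have k2 := killingForm_lie_self (h : G₀) q
  rw [e1] at k1
  rw [e2] at k2
  simp only [map_add, map_neg, map_smul, LinearMap.add_apply, LinearMap.neg_apply,
    LinearMap.smul_apply, smul_eq_mul] at k1 k2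
  have kc : killingForm ℝ G₀ p q = killingForm ℝ G₀ q p := LieModule.traceForm_comm ℝ G₀ G₀ p q
  have hp : killingForm ℝ G₀ p p ≤ 0 := by
    by_cases h0 : p = 0
    · simp [h0]
    · exact (hG₀ p h0).le
  have hq : killingForm ℝ G₀ q q ≤ 0 := by
    by_cases h0 : q = 0
    · simp [h0]
    · exact (hG₀ q h0).le
  have hlt : killingForm ℝ G₀ p p + killingForm ℝ G₀ q q < 0 := by
    by_cases h0 : p = 0
    · have hq0 : q ≠ 0 := by
        rintro rfl
        exact hv0 (by simp [h0])
      exact add_neg_of_nonpos_of_neg hp (hG₀ q hq0)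
    · exact add_neg_of_neg_of_nonpos (hG₀ p h0) hq
  -- With `[h, p] = Re c p - Im c q` and `[h, q] = Im c p + Re c q`, the mixed terms cancel in the
  -- sum of `B([h, p], p) = 0` and `B([h, q], q) = 0`.
  refine (mul_eq_zero.1 (?_ : c.re * (killingForm ℝ G₀ p p + killingForm ℝ G₀ q q) = 0)).resolve_right
    hlt.ne
  linear_combination k1 + k2 - c.im * kc

/-- The element of `H₀` that represents the imaginary part of a root. -/
theorem exists_killingForm_eq_im (hG₀ : IsCompactSemisimple G₀) (α : Module.Dual ℂ (cplx H₀)) :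
    ∃ t : H₀, ∀ h : H₀, killingForm ℝ G₀ h t = (α (cplxIncl H₀ h)).im := by
  let b : LinearMap.BilinForm ℝ H₀ := (killingForm ℝ G₀).restrict H₀.toSubmodule
  have hsymm : ∀ x y, b x y = b y x := fun x y => LieModule.traceForm_comm ℝ G₀ G₀ _ _
  have hb : b.Nondegenerate := by
    have hs : ∀ x, (∀ y, b x y = 0) → x = 0 := by
      intro x hx
      by_contra hne
      exact (hG₀ x (fun h0 => hne (Subtype.ext h0))).ne (hx x)
    exact ⟨hs, fun x hx => hs x fun y => by rw [hsymm]; exact hx y⟩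
  let F : Module.Dual ℝ H₀ := Complex.imLm ∘ₗ α.restrictScalars ℝ ∘ₗ cplxIncl H₀
  refine ⟨(b.toDual hb).symm F, fun h => ?_⟩
  have e := LinearEquiv.apply_symm_apply (b.toDual hb) F
  have e' := LinearMap.congr_fun e h
  rw [LinearMap.BilinForm.toDual_def, hsymm] at e'
  exact e'

/-- Since `α` is imaginary on `H₀`, it equals `i B(·, t)` there for some `t` in `H₀`, nonzero
because `α` is. So `i t` represents `α`, and `α(i t) = -B(t, t)` does not vanish; the normalisation
of `τ_α` then gives `2`. -/
theorem root_coroot (hG₀ : IsCompactSemisimple G₀) {α : Module.Dual ℂ (cplx H₀)}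
    (hα : α ∈ roots (cplx H₀)) : α (coroot (cplx H₀) α) = 2 := by
  obtain ⟨t, ht⟩ := exists_killingForm_eq_im hG₀ α
  have hαI : ∀ h : H₀, α (cplxIncl H₀ h) = Complex.I * (killingForm ℝ G₀ h t : ℝ) := by
    intro h
    apply Complex.ext <;> simp [ht, root_re_eq_zero hG₀ hα]
  let s : cplx H₀ := Complex.I • cplxIncl H₀ t
  have hs : ∀ h : cplx H₀, killingForm ℂ (ℂ ⊗[ℝ] G₀) (h : ℂ ⊗[ℝ] G₀) (s : ℂ ⊗[ℝ] G₀) = α h := by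
    intro h
    refine LinearMap.congr_fun (linearMap_ext_cplx
      (f := ((killingForm ℂ (ℂ ⊗[ℝ] G₀)).flip (s : ℂ ⊗[ℝ] G₀)) ∘ₗ
        (cplx H₀).toSubmodule.subtype) (g := α) fun h => ?_) h
    change killingForm ℂ (ℂ ⊗[ℝ] G₀) ((1 : ℂ) ⊗ₜ (h : G₀)) (Complex.I • ((1 : ℂ) ⊗ₜ (t : G₀))) = _
    rw [map_smul, killingForm_baseChange, LinearMap.BilinForm.baseChange_tmul, hαI]
    simp
  have hr : ∀ h : cplx H₀, killingForm ℂ (ℂ ⊗[ℝ] G₀) (h : ℂ ⊗[ℝ] G₀)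
      (rootVector (cplx H₀) α : ℂ ⊗[ℝ] G₀) = α h := by
    have e : ∃ t : cplx H₀, ∀ h : cplx H₀,
      killingForm ℂ (ℂ ⊗[ℝ] G₀) (h : ℂ ⊗[ℝ] G₀) (t : ℂ ⊗[ℝ] G₀) = α h := ⟨s, hs⟩
    rw [rootVector, dif_pos e]
    exact e.choose_spec
  have ht0 : (t : G₀) ≠ 0 := by
    intro h0
    apply hα.1
    refine linearMap_ext_cplx fun h => ?_
    rw [hαI, h0, map_zero]
    simp
  have hrr : α (rootVector (cplx H₀) α) ≠ 0 := by
    -- By symmetry of the form, `α` takes the same value at any two elements that represent it, so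
    -- uniqueness of the representative is not needed.
    rw [← hs, LieModule.traceForm_comm, hr]
    have : α s = Complex.I * α (cplxIncl H₀ t) := by rw [map_smul, smul_eq_mul]
    rw [this, hαI, ← mul_assoc, Complex.I_mul_I]
    have := (hG₀ t ht0).ne
    simpa using this
  rw [coroot, map_smul, hr, smul_eq_mul, div_mul_cancel₀ _ hrr]

variable {X : Module.Dual ℂ (cplx H₀) → ℂ ⊗[ℝ] G₀}

/-- Up to sign `X_{-α}` is the conjugate of `X_α`, and conjugation replaces `α` by `-α` because `α`
is imaginary on `H₀`. -/
theorem IsAdapted.mem_neg (hG₀ : IsCompactSemisimple G₀) (hX : IsAdapted H₀ X)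
    {α : Module.Dual ℂ (cplx H₀)} (hα : α ∈ roots (cplx H₀)) :
    X (-α) ∈ rootSpace (cplx H₀) (-α) := by
  have hc : conjugation G₀ (X α) ∈ rootSpace (cplx H₀) (-α) := by
    refine mem_wtSpace_cplx.2 fun h => ?_
    have e := congrArg (conjugation G₀) (mem_wtSpace_cplx.1 (hX.mem α hα) h)
    rw [conjugation_lie, conjugation_smul, coe_cplxIncl, conjugation_tmul, map_one] at e
    rw [coe_cplxIncl]
    refine e.trans ?_
    congr 1
    apply Complex.ext <;> simp [root_re_eq_zero hG₀ hα h]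
  rw [hX.conjugation_eq α hα] at hc
  exact neg_mem_iff.1 hc

theorem IsAdapted.isSl2Triple (hG₀ : IsCompactSemisimple G₀) (hX : IsAdapted H₀ X)
    {α : Module.Dual ℂ (cplx H₀)} (hα : α ∈ roots (cplx H₀)) :
    IsSl2Triple (coroot (cplx H₀) α : ℂ ⊗[ℝ] G₀) (X α) (X (-α)) where
  h_ne_zero h0 := by
    have h1 : coroot (cplx H₀) α = 0 := Subtype.ext h0
    have := root_coroot hG₀ hα
    rw [h1, map_zero] at this
    exact two_ne_zero this.symm
  lie_e_f := hX.lie_neg α hα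
  lie_h_e_nsmul := by
    refine (hX.mem α hα (coroot (cplx H₀) α)).trans ?_
    rw [root_coroot hG₀ hα, ofNat_smul_eq_nsmul ℂ 2]
  lie_h_f_nsmul := by
    refine (hX.mem_neg hG₀ hα (coroot (cplx H₀) α)).trans ?_
    rw [LinearMap.neg_apply, root_coroot hG₀ hα, neg_smul, ofNat_smul_eq_nsmul ℂ 2]

end CompactRoots

/-! ### Automorphisms of two-step nilpotent Lie algebras -/

section TwoStepAutomorphism

variable {K L V : Type*} [Field K] [CharZero K] [LieRing L] [LieAlgebra K L]
  [FiniteDimensional K L] [AddCommGroup V] [Module K V] [LieRingModule L V] [LieModule K L V]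

/-- A pair of compatible isometries of `V` and `L` is an automorphism of `V ⊕ L`. -/
theorem exists_twoStep_lieEquiv (B : InvForm K L V) (T : V ≃ₗ[K] V) (φ : L ≃ₗ[K] L)
    (hT : ∀ v v', B.formV (T v) (T v') = B.formV v v')
    (hφ : ∀ y z, B.formL (φ y) (φ z) = B.formL y z)
    (hlie : ∀ y v, T ⁅y, v⁆ = ⁅φ y, T v⁆) :
    ∃ e : TwoStep B ≃ₗ⁅K⁆ TwoStep B,
      ∀ p : V × L, e (TwoStep.mk B p) = TwoStep.mk B (T p.1, φ p.2) := by
  -- Every `z` has the form `φ y`, and invariance of both forms reduces the pairing with `φ y` to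
  -- the defining property of the bracket at `y`.
  have hmoment : ∀ v v', TwoStep.moment B (T v) (T v') = φ (TwoStep.moment B v v') := by
    intro v v'
    rw [TwoStep.moment_eq_iff]
    intro z
    obtain ⟨y, rfl⟩ := φ.surjective z
    rw [hφ, TwoStep.formL_moment, ← hlie, hT]
  let E : TwoStep B ≃ₗ[K] TwoStep B :=
    (TwoStep.mk B).symm ≪≫ₗ (T.prodCongr φ) ≪≫ₗ TwoStep.mk B
  refine ⟨{ E with
    map_lie' := ?_ }, fun p => rfl⟩
  intro p q
  obtain ⟨p, rfl⟩ := (TwoStep.mk B).surjective p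
  obtain ⟨q, rfl⟩ := (TwoStep.mk B).surjective q
  change E ⁅TwoStep.mk B p, TwoStep.mk B q⁆ =
    ⁅TwoStep.mk B (T p.1, φ p.2), TwoStep.mk B (T q.1, φ q.2)⁆
  rw [TwoStep.bracket_mk, TwoStep.bracket_mk]
  change TwoStep.mk B (T 0, φ (TwoStep.moment B p.1 q.1)) = _
  rw [map_zero, hmoment]

end TwoStepAutomorphism

/-! ### The operators of words in the roots -/

section Words

variable {G₀ M N : Type*} [LieRing G₀] [LieAlgebra ℝ G₀]
  [AddCommGroup M] [Module ℝ M] [LieRingModule G₀ M] [LieModule ℝ G₀ M]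
  [AddCommGroup N] [Module ℝ N] [LieRingModule G₀ N] [LieModule ℝ G₀ N]
  {H₀ : LieSubalgebra ℝ G₀} {X : Module.Dual ℂ (cplx H₀) → ℂ ⊗[ℝ] G₀}
  {w : List (Module.Dual ℂ (cplx H₀))}

theorem weylOp_cons_apply (α : Module.Dual ℂ (cplx H₀)) (m : ℂ ⊗[ℝ] M) :
    weylOp M X (α :: w) m = slTwoOp M (X α) (X (-α)) (weylOp M X w m) := by
  rw [weylOp, List.map_cons, List.prod_cons]
  rfl

theorem map_weylOp_range_realIncl {g : M ≃ₗ[ℝ] M}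
    (hg : ∀ m, realIncl M (g m) = weylOp M X w (realIncl M m)) :
    (LinearMap.range (realIncl M)).map ((weylOp M X w).restrictScalars ℝ) =
      LinearMap.range (realIncl M) := by
  have e : (weylOp M X w).restrictScalars ℝ ∘ₗ realIncl M = realIncl M ∘ₗ (g : M →ₗ[ℝ] M) :=
    LinearMap.ext fun m => (hg m).symm
  rw [← LinearMap.range_comp, e, LinearMap.range_comp_of_range_eq_top _ g.range]

variable [FiniteDimensional ℝ G₀]

theorem weylReflection_mul_self (hG₀ : IsCompactSemisimple G₀) {α : Module.Dual ℂ (cplx H₀)}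
    (hα : α ∈ roots (cplx H₀)) :
    weylReflection (cplx H₀) α * weylReflection (cplx H₀) α = 1 := by
  refine LinearMap.ext fun h => ?_
  rw [Module.End.mul_apply]
  exact Module.involutive_preReflection (root_coroot hG₀ hα) h

/-- Every element of the Weyl group is a product of reflections. -/
theorem exists_isWord (hG₀ : IsCompactSemisimple G₀) {σ : cplx H₀ ≃ₗ[ℂ] cplx H₀}
    (hσ : σ ∈ weylGroup (cplx H₀)) : ∃ w, IsWord w σ := by
  induction hσ using Subgroup.closure_induction with
  | mem s hs =>
    obtain ⟨α, hα, h⟩ := hs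
    exact ⟨[α], by simpa using hα, by simpa using h.symm⟩
  | one => exact ⟨[], by simp, rfl⟩
  | mul s t _ _ hs ht =>
    obtain ⟨v, hv, hv'⟩ := hs
    obtain ⟨w, hw, hw'⟩ := ht
    refine ⟨v ++ w, fun α hα => (List.mem_append.1 hα).elim (hv α) (hw α), ?_⟩
    rw [List.map_append, List.prod_append, hv', hw']
    rfl
  | inv s _ hs =>
    obtain ⟨w, hw, hw'⟩ := hs
    refine ⟨w.reverse, fun α hα => hw α (List.mem_reverse.1 hα), ?_⟩
    -- Reflections are involutions, so the reversed word represents the inverse.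
    have hinv : ∀ w : List (Module.Dual ℂ (cplx H₀)), (∀ α ∈ w, α ∈ roots (cplx H₀)) →
        (w.reverse.map (weylReflection (cplx H₀))).prod *
          (w.map (weylReflection (cplx H₀))).prod = 1 := by
      intro w hw
      induction w with
      | nil => simp
      | cons α w ih =>
        rw [List.forall_mem_cons] at hw
        rw [List.reverse_cons, List.map_append, List.prod_append, List.map_singleton,
          List.prod_singleton, List.map_cons, List.prod_cons, mul_assoc,
          ← mul_assoc (weylReflection _ α),
          weylReflection_mul_self hG₀ hw.1, one_mul, ih hw.2]
    have h1 := hinv w hw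
    rw [hw'] at h1
    refine LinearMap.ext fun x => ?_
    have h2 := LinearMap.congr_fun h1 (s⁻¹ x)
    rw [Module.End.mul_apply] at h2
    have h3 : (s : cplx H₀ →ₗ[ℂ] cplx H₀) (s⁻¹ x) = x := s.apply_symm_apply x
    rw [h3] at h2
    exact h2

variable [FiniteDimensional ℝ M] [FiniteDimensional ℝ N]

theorem weylOp_lie (hG₀ : IsCompactSemisimple G₀) (hX : IsAdapted H₀ X)
    (hw : ∀ α ∈ w, α ∈ roots (cplx H₀)) (y : ℂ ⊗[ℝ] G₀) (m : ℂ ⊗[ℝ] M) :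
    weylOp M X w ⁅y, m⁆ = ⁅weylOp G₀ X w y, weylOp M X w m⁆ := by
  induction w with
  | nil => rfl
  | cons α w ih =>
    rw [List.forall_mem_cons] at hw
    rw [weylOp_cons_apply, ih hw.2, slTwoOp_lie (hX.isSl2Triple hG₀ hw.1), weylOp_cons_apply,
      weylOp_cons_apply]

theorem weylOp_bijective (hG₀ : IsCompactSemisimple G₀) (hX : IsAdapted H₀ X)
    (hw : ∀ α ∈ w, α ∈ roots (cplx H₀)) : Function.Bijective (weylOp M X w) := by
  induction w with
  | nil => exact Function.bijective_id
  | cons α w ih =>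
    rw [List.forall_mem_cons] at hw
    have t := hX.isSl2Triple hG₀ hw.1
    have hb : Function.Bijective (slTwoOp M (X α) (X (-α))) :=
      Function.bijective_iff_has_inverse.2 ⟨slTwoOp M (-X α) (-X (-α)),
        LinearMap.congr_fun (slTwoOp_neg_mul t), LinearMap.congr_fun (slTwoOp_mul_neg t)⟩
    have e : ⇑(weylOp M X (α :: w)) = slTwoOp M (X α) (X (-α)) ∘ weylOp M X w :=
      funext (weylOp_cons_apply α)
    rw [e]
    exact hb.comp (ih hw.2)

/-- An element `k` of `H` scales `X_α` by `α(k)` and `X_{-α}` by `-α(k)`, so the `sl₂` computation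
yields `k - α(k) τ_α`. -/
theorem weylOp_coe (hG₀ : IsCompactSemisimple G₀) (hX : IsAdapted H₀ X)
    (hw : ∀ α ∈ w, α ∈ roots (cplx H₀)) (h : cplx H₀) :
    weylOp G₀ X w (h : ℂ ⊗[ℝ] G₀) =
      (((w.map (weylReflection (cplx H₀))).prod h : cplx H₀) : ℂ ⊗[ℝ] G₀) := by
  induction w with
  | nil => rfl
  | cons α w ih =>
    rw [List.forall_mem_cons] at hw
    rw [weylOp_cons_apply, ih hw.2, List.map_cons, List.prod_cons, Module.End.mul_apply]
    set k := (w.map (weylReflection (cplx H₀))).prod h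
    rw [slTwoOp_of_lie (hX.isSl2Triple hG₀ hw.1) (hX.mem α hw.1 k)
      ((hX.mem_neg hG₀ hw.1 k).trans (by rw [LinearMap.neg_apply, neg_smul]))]
    rw [weylReflection, Module.preReflection_apply]
    rfl

/-- Conjugation exchanges the actions of `X_α` and `-X_{-α}`, which turns each factor into its other
form under the braid relation. -/
theorem conjugation_weylOp (hG₀ : IsCompactSemisimple G₀) (hX : IsAdapted H₀ X)
    (hw : ∀ α ∈ w, α ∈ roots (cplx H₀)) (m : ℂ ⊗[ℝ] M) :
    conjugation M (weylOp M X w m) = weylOp M X w (conjugation M m) := by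
  induction w with
  | nil => rfl
  | cons α w ih =>
    rw [List.forall_mem_cons] at hw
    rw [weylOp_cons_apply, weylOp_cons_apply, ← ih hw.2]
    refine map_slTwoOp (hX.isSl2Triple hG₀ hw.1) (conjugation M).toAddMonoidHom ?_ ?_ _
    · intro m
      refine (conjugation_lie _ _).trans ?_
      rw [hX.conjugation_eq α hw.1]
      rfl
    · intro m
      refine (conjugation_lie _ _).trans ?_
      rw [map_neg, conjugation_neg hX hw.1, neg_neg]
      rfl

/-- The operators of words preserve every invariant pairing. -/
theorem pairing_weylOp_of_skew {R : Type*} [AddCommGroup R] [Module ℂ R]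
    (hG₀ : IsCompactSemisimple G₀) (hX : IsAdapted H₀ X)
    (hw : ∀ α ∈ w, α ∈ roots (cplx H₀))
    (b : (ℂ ⊗[ℝ] M) →+ (ℂ ⊗[ℝ] N) →+ R) (hb : ∀ (x : ℂ ⊗[ℝ] G₀) m n, b ⁅x, m⁆ n = -(b m ⁅x, n⁆))
    (m : ℂ ⊗[ℝ] M) (n : ℂ ⊗[ℝ] N) :
    b (weylOp M X w m) (weylOp N X w n) = b m n := by
  induction w with
  | nil => rfl
  | cons α w ih =>
    rw [List.forall_mem_cons] at hw
    rw [weylOp_cons_apply, weylOp_cons_apply, pairing_slTwoOp_of_skew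
      (hX.isSl2Triple hG₀ hw.1) b (hb _) (hb _), ih hw.2]

/-- The operators of words preserve every pairing that is invariant up to conjugation. -/
theorem pairing_weylOp_of_skewHermitian {R : Type*} [AddCommGroup R] [Module ℂ R]
    (hG₀ : IsCompactSemisimple G₀) (hX : IsAdapted H₀ X)
    (hw : ∀ α ∈ w, α ∈ roots (cplx H₀))
    (b : (ℂ ⊗[ℝ] M) →+ (ℂ ⊗[ℝ] N) →+ R)
    (hb : ∀ (x : ℂ ⊗[ℝ] G₀) m n, b ⁅x, m⁆ n = b m ⁅-conjugation G₀ x, n⁆)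
    (m : ℂ ⊗[ℝ] M) (n : ℂ ⊗[ℝ] N) :
    b (weylOp M X w m) (weylOp N X w n) = b m n := by
  induction w with
  | nil => rfl
  | cons α w ih =>
    rw [List.forall_mem_cons] at hw
    rw [weylOp_cons_apply, weylOp_cons_apply, pairing_slTwoOp_of_adjoint
      (hX.isSl2Triple hG₀ hw.1) b
      (fun m n => by rw [hb, hX.conjugation_eq α hw.1, neg_neg])
      (fun m n => by rw [hb, conjugation_neg hX hw.1, neg_neg]), ih hw.2]

/-- The restriction of the operator of a word to the real form. -/
theorem exists_weylOp_realIncl (hG₀ : IsCompactSemisimple G₀) (hX : IsAdapted H₀ X)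
    (hw : ∀ α ∈ w, α ∈ roots (cplx H₀)) :
    ∃ g : M ≃ₗ[ℝ] M, ∀ m, realIncl M (g m) = weylOp M X w (realIncl M m) := by
  let g : M →ₗ[ℝ] M := realPart M ∘ₗ (weylOp M X w).restrictScalars ℝ ∘ₗ realIncl M
  -- The operator commutes with conjugation and so preserves the fixed points; taking the real part
  -- loses nothing.
  have hg : ∀ m, realIncl M (g m) = weylOp M X w (realIncl M m) := fun m =>
    realIncl_realPart (by
      change conjugation M (weylOp M X w (realIncl M m)) = weylOp M X w (realIncl M m)
      rw [conjugation_weylOp hG₀ hX hw, conjugation_realIncl])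
  have hinj : Function.Injective g := fun m m' h => by
    have h' := congrArg (realIncl M) h
    rw [hg, hg] at h'
    exact realIncl_injective ((weylOp_bijective hG₀ hX hw).1 h')
  exact ⟨LinearEquiv.ofInjectiveEndo g hinj, hg⟩

/-- The restrictions to the real forms preserve every invariant pairing. -/
theorem pairing_of_realIncl_eq (hG₀ : IsCompactSemisimple G₀) (hX : IsAdapted H₀ X)
    (hw : ∀ α ∈ w, α ∈ roots (cplx H₀)) (b : M →ₗ[ℝ] N →ₗ[ℝ] ℝ)
    (hb : ∀ (x : G₀) m n, b ⁅x, m⁆ n + b m ⁅x, n⁆ = 0) {g : M → M} {k : N → N}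
    (hg : ∀ m, realIncl M (g m) = weylOp M X w (realIncl M m))
    (hk : ∀ n, realIncl N (k n) = weylOp N X w (realIncl N n)) (m : M) (n : N) :
    b (g m) (k n) = b m n := by
  -- The complex bilinear extension of `b`, with values in `ℂ ⊗ ℝ`; skewness passes to all of `G₀^ℂ`
  -- through pure tensors.
  let c : (ℂ ⊗[ℝ] M) →ₗ[ℝ] (ℂ ⊗[ℝ] N) →ₗ[ℝ] (ℂ ⊗[ℝ] ℝ) :=
    TensorProduct.map₂ (LinearMap.mul ℝ ℂ) b
  have hc : ∀ (x : ℂ ⊗[ℝ] G₀) m n, c ⁅x, m⁆ n = -(c m ⁅x, n⁆) := by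
    intro x m n
    induction x using TensorProduct.induction_on with
    | zero => simp
    | add x y hx hy => simp only [add_lie, map_add, LinearMap.add_apply, hx, hy, neg_add]
    | tmul z x =>
      induction m using TensorProduct.induction_on with
      | zero => rw [cplx_lie_zero, map_zero, LinearMap.zero_apply, LinearMap.zero_apply, neg_zero]
      | add v w hv hw =>
        simp only [cplx_lie_add, map_add, LinearMap.add_apply, hv, hw, neg_add]
      | tmul d m =>
        induction n using TensorProduct.induction_on with
        | zero => rw [cplx_lie_zero, map_zero, map_zero, neg_zero]
        | add v w hv hw => simp only [cplx_lie_add, map_add, hv, hw, neg_add]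
        | tmul d' n =>
          simp only [LieAlgebra.ExtendScalars.bracket_tmul, c, TensorProduct.map₂_apply_tmul,
            TensorProduct.map_tmul, LinearMap.mul_apply', eq_neg_of_add_eq_zero_left (hb x m n),
            TensorProduct.tmul_neg]
          rw [show z * d * d' = d * (z * d') by ring]
  have key := pairing_weylOp_of_skew hG₀ hX hw
    (AddMonoidHom.mk' (fun m => (c m).toAddMonoidHom) fun m m' => by
      ext n; exact LinearMap.congr_fun (map_add c m m') n) hc (realIncl M m) (realIncl N n)
  rw [← hg, ← hk] at key
  have key' := congrArg (fun z => TensorProduct.lid ℝ ℂ (TensorProduct.comm ℝ ℂ ℝ z)) key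
  change (b (g m) (k n)) • ((1 : ℂ) * 1) = b m n • ((1 : ℂ) * 1) at key'
  simpa using key'

/-- The operators of words preserve every invariant bilinear form. -/
theorem bilinPairing_weylOp (hG₀ : IsCompactSemisimple G₀) (hX : IsAdapted H₀ X)
    (hw : ∀ α ∈ w, α ∈ roots (cplx H₀)) (b : LinearMap.BilinForm ℂ (ℂ ⊗[ℝ] M))
    (hb : ∀ (x : ℂ ⊗[ℝ] G₀) m n, b ⁅x, m⁆ n + b m ⁅x, n⁆ = 0) (m n : ℂ ⊗[ℝ] M) :
    b (weylOp M X w m) (weylOp M X w n) = b m n :=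
  pairing_weylOp_of_skew hG₀ hX hw
    (AddMonoidHom.mk' (fun m => (b m).toAddMonoidHom) fun m m' => by
      ext n; exact LinearMap.congr_fun (map_add b m m') n)
    (fun x m n => eq_neg_of_add_eq_zero_left (hb x m n)) m n

/-- The operators of words preserve every sesquilinear pairing for which `G₀` is skew. -/
theorem sesqPairing_weylOp (hG₀ : IsCompactSemisimple G₀) (hX : IsAdapted H₀ X)
    (hw : ∀ α ∈ w, α ∈ roots (cplx H₀)) (b : (ℂ ⊗[ℝ] M) →ₗ⋆[ℂ] (ℂ ⊗[ℝ] N) →ₗ[ℂ] ℂ)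
    (hb : ∀ (x : G₀) m n, b ⁅realIncl G₀ x, m⁆ n + b m ⁅realIncl G₀ x, n⁆ = 0)
    (m : ℂ ⊗[ℝ] M) (n : ℂ ⊗[ℝ] N) :
    b (weylOp M X w m) (weylOp N X w n) = b m n := by
  refine pairing_weylOp_of_skewHermitian hG₀ hX hw
    (AddMonoidHom.mk' (fun m => (b m).toAddMonoidHom) fun m m' => by
      ext n; exact LinearMap.congr_fun (map_add b m m') n) ?_ m n
  intro x m n
  -- A scalar leaves the first argument conjugated, so skewness for `G₀` says that the adjoint of
  -- any `x` in `G₀^ℂ` is `-J₀(x)`. In particular `X_α` and `X_{-α}` become adjoint.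
  change b ⁅x, m⁆ n = b m ⁅-conjugation G₀ x, n⁆
  induction x using TensorProduct.induction_on with
  | zero => simp
  | add x y hx hy =>
    simp only [add_lie, map_add, LinearMap.add_apply, hx, hy, neg_add]
  | tmul c x =>
    have e1 : (c ⊗ₜ[ℝ] x : ℂ ⊗[ℝ] G₀) = c • realIncl G₀ x := by
      rw [realIncl, TensorProduct.mk_apply, TensorProduct.smul_tmul', smul_eq_mul, mul_one]
    have e2 : ⁅c • realIncl G₀ x, m⁆ = c • ⁅realIncl G₀ x, m⁆ :=
      smul_lie c (realIncl G₀ x) m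
    have e3 : ⁅-(conj c • realIncl G₀ x), n⁆ = -(conj c • ⁅realIncl G₀ x, n⁆) :=
      (neg_lie _ _).trans (congrArg Neg.neg (smul_lie (conj c) (realIncl G₀ x) n))
    rw [e1, conjugation_smul, conjugation_realIncl, e2, e3, LinearMap.map_smulₛₗ, map_neg,
      map_smul, LinearMap.smul_apply, eq_neg_of_add_eq_zero_left (hb x m n), smul_neg]

/-- `ζ_σ` preserves every sesquilinear form for which `G₀` is skew. -/
theorem sesqPairing_zeta (hG₀ : IsCompactSemisimple G₀) (hX : IsAdapted H₀ X)
    (hw : ∀ α ∈ w, α ∈ roots (cplx H₀))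
    (h : ((ℂ ⊗[ℝ] M) × (ℂ ⊗[ℝ] G₀)) →ₗ⋆[ℂ] ((ℂ ⊗[ℝ] M) × (ℂ ⊗[ℝ] G₀)) →ₗ[ℂ] ℂ)
    (hh : ∀ (x : G₀) p q,
      h (diagAct (realIncl G₀ x) p) q + h p (diagAct (realIncl G₀ x) q) = 0)
    (p q : (ℂ ⊗[ℝ] M) × (ℂ ⊗[ℝ] G₀)) :
    h (zeta M X w p) (zeta M X w q) = h p q := by
  have hl : ∀ (x : G₀) (m : ℂ ⊗[ℝ] M),
      diagAct (realIncl G₀ x) (m, (0 : ℂ ⊗[ℝ] G₀)) = (⁅realIncl G₀ x, m⁆, 0) := fun x m =>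
    Prod.ext rfl (cplx_lie_zero _)
  have hr : ∀ (x : G₀) (y : ℂ ⊗[ℝ] G₀),
      diagAct (realIncl G₀ x) ((0 : ℂ ⊗[ℝ] M), y) = (0, ⁅realIncl G₀ x, y⁆) := fun x m =>
    Prod.ext (cplx_lie_zero _) rfl
  let i := LinearMap.inl ℂ (ℂ ⊗[ℝ] M) (ℂ ⊗[ℝ] G₀)
  let j := LinearMap.inr ℂ (ℂ ⊗[ℝ] M) (ℂ ⊗[ℝ] G₀)
  -- The form need not make `V` and `G` orthogonal. The off-diagonal blocks are invariant pairings
  -- between two different modules.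
  have h11 := sesqPairing_weylOp hG₀ hX hw ((h ∘ₛₗ i).compl₂ i) fun x m n => by
    have := hh x (m, 0) (n, 0)
    rwa [hl, hl] at this
  have h12 := sesqPairing_weylOp hG₀ hX hw ((h ∘ₛₗ i).compl₂ j) fun x m n => by
    have := hh x (m, 0) (0, n)
    rwa [hl, hr] at this
  have h21 := sesqPairing_weylOp hG₀ hX hw ((h ∘ₛₗ j).compl₂ i) fun x m n => by
    have := hh x (0, m) (n, 0)
    rwa [hr, hl] at this
  have h22 := sesqPairing_weylOp hG₀ hX hw ((h ∘ₛₗ j).compl₂ j) fun x m n => by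
    have := hh x (0, m) (0, n)
    rwa [hr, hr] at this
  have hsplit : ∀ p q : (ℂ ⊗[ℝ] M) × (ℂ ⊗[ℝ] G₀), h p q =
      (h ∘ₛₗ i).compl₂ i p.1 q.1 + (h ∘ₛₗ i).compl₂ j p.1 q.2 +
        ((h ∘ₛₗ j).compl₂ i p.2 q.1 + (h ∘ₛₗ j).compl₂ j p.2 q.2) := by
    intro p q
    have e : ∀ p : (ℂ ⊗[ℝ] M) × (ℂ ⊗[ℝ] G₀), p = i p.1 + j p.2 := fun p => by simp [i, j]
    conv_lhs => rw [e p, e q]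
    simp only [map_add, LinearMap.add_apply]
    change h (i p.1) (i q.1) + h (j p.2) (i q.1) + (h (i p.1) (j q.2) + h (j p.2) (j q.2)) =
      h (i p.1) (i q.1) + h (i p.1) (j q.2) + (h (j p.2) (i q.1) + h (j p.2) (j q.2))
    ring
  rw [hsplit, hsplit p q]
  exact congrArg₂ _ (congrArg₂ _ (h11 _ _) (h12 _ _)) (congrArg₂ _ (h21 _ _) (h22 _ _))

/-- The restriction of `ζ_σ` to the real form preserves every bilinear form for which `G₀` is
skew. -/
theorem pairing_prodMap_of_realIncl_eq (hG₀ : IsCompactSemisimple G₀) (hX : IsAdapted H₀ X)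
    (hw : ∀ α ∈ w, α ∈ roots (cplx H₀)) (b : LinearMap.BilinForm ℝ (M × G₀))
    (hb : ∀ (x : G₀) p q, b (diagAct x p) q + b p (diagAct x q) = 0) {g : M → M} {k : G₀ → G₀}
    (hg : ∀ m, realIncl M (g m) = weylOp M X w (realIncl M m))
    (hk : ∀ y, realIncl G₀ (k y) = weylOp G₀ X w (realIncl G₀ y)) (p q : M × G₀) :
    b (g p.1, k p.2) (g q.1, k q.2) = b p q := by
  have hl : ∀ (x : G₀) (m : M), diagAct x (m, (0 : G₀)) = (⁅x, m⁆, 0) := fun x m =>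
    Prod.ext rfl (lie_zero _)
  have hr : ∀ (x y : G₀), diagAct x ((0 : M), y) = (0, ⁅x, y⁆) := fun x m =>
    Prod.ext (lie_zero _) rfl
  let i := LinearMap.inl ℝ M G₀
  let j := LinearMap.inr ℝ M G₀
  -- Again `M` and `G₀` need not be orthogonal, and each of the four blocks is an invariant pairing.
  have h11 := pairing_of_realIncl_eq hG₀ hX hw (b.compl₁₂ i i) (fun x m n => by
    have := hb x (m, 0) (n, 0)
    rwa [hl, hl] at this) hg hg
  have h12 := pairing_of_realIncl_eq hG₀ hX hw (b.compl₁₂ i j) (fun x m n => by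
    have := hb x (m, 0) (0, n)
    rwa [hl, hr] at this) hg hk
  have h21 := pairing_of_realIncl_eq hG₀ hX hw (b.compl₁₂ j i) (fun x m n => by
    have := hb x (0, m) (n, 0)
    rwa [hr, hl] at this) hk hg
  have h22 := pairing_of_realIncl_eq hG₀ hX hw (b.compl₁₂ j j) (fun x m n => by
    have := hb x (0, m) (0, n)
    rwa [hr, hr] at this) hk hk
  have hsplit : ∀ p q : M × G₀, b p q = b.compl₁₂ i i p.1 q.1 + b.compl₁₂ i j p.1 q.2 +
        (b.compl₁₂ j i p.2 q.1 + b.compl₁₂ j j p.2 q.2) := by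
    intro p q
    have e : ∀ p : M × G₀, p = i p.1 + j p.2 := fun p => by simp [i, j]
    conv_lhs => rw [e p, e q]
    simp only [map_add, LinearMap.add_apply, LinearMap.compl₁₂_apply]
    ring
  rw [hsplit, hsplit p q]
  exact congrArg₂ _ (congrArg₂ _ (h11 _ _) (h12 _ _)) (congrArg₂ _ (h21 _ _) (h22 _ _))

/-- The operators of words permute the weight spaces. -/
theorem map_weylOp_wtSpace (hG₀ : IsCompactSemisimple G₀) (hX : IsAdapted H₀ X)
    (hw : ∀ α ∈ w, α ∈ roots (cplx H₀)) {σ : cplx H₀ ≃ₗ[ℂ] cplx H₀}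
    (hlie : ∀ (h : cplx H₀) (m : ℂ ⊗[ℝ] M), weylOp M X w ⁅(h : ℂ ⊗[ℝ] G₀), m⁆ =
      ⁅(σ h : ℂ ⊗[ℝ] G₀), weylOp M X w m⁆) (μ : Module.Dual ℂ (cplx H₀)) :
    (wtSpace (ℂ ⊗[ℝ] M) (cplx H₀) μ).map (weylOp M X w) =
      wtSpace (ℂ ⊗[ℝ] M) (cplx H₀) (dualAct σ μ) := by
  apply le_antisymm
  · rintro - ⟨m, hm, rfl⟩ h
    have e := hlie (σ.symm h) m
    rw [σ.apply_symm_apply, hm, map_smul] at e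
    exact e.symm
  · intro n hn
    obtain ⟨m, rfl⟩ := (weylOp_bijective hG₀ hX hw).2 n
    refine ⟨m, fun h => (weylOp_bijective hG₀ hX hw).1 ?_, rfl⟩
    rw [hlie, hn, map_smul]
    congr 1
    exact congrArg μ (σ.symm_apply_apply h)

/-- The operators of words permute the real weight spaces. -/
theorem map_weylOp_realWtSpace (hG₀ : IsCompactSemisimple G₀) (hX : IsAdapted H₀ X)
    (hw : ∀ α ∈ w, α ∈ roots (cplx H₀)) {σ : cplx H₀ ≃ₗ[ℂ] cplx H₀}
    (hlie : ∀ (h : cplx H₀) (m : ℂ ⊗[ℝ] M), weylOp M X w ⁅(h : ℂ ⊗[ℝ] G₀), m⁆ =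
      ⁅(σ h : ℂ ⊗[ℝ] G₀), weylOp M X w m⁆) (μ : Module.Dual ℂ (cplx H₀)) :
    (realWtSpace (H₀ := H₀) M μ).map ((weylOp M X w).restrictScalars ℝ) =
      realWtSpace M (dualAct σ μ) := by
  obtain ⟨g, hg⟩ := exists_weylOp_realIncl (M := M) hG₀ hX hw
  have hsup : ((wtSpace (ℂ ⊗[ℝ] M) (cplx H₀) μ ⊔
      wtSpace (ℂ ⊗[ℝ] M) (cplx H₀) (-μ)).restrictScalars ℝ).map
        ((weylOp M X w).restrictScalars ℝ) =
      (wtSpace (ℂ ⊗[ℝ] M) (cplx H₀) (dualAct σ μ) ⊔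
        wtSpace (ℂ ⊗[ℝ] M) (cplx H₀) (-dualAct σ μ)).restrictScalars ℝ := by
    rw [← map_weylOp_wtSpace hG₀ hX hw hlie μ,
      show -dualAct σ μ = dualAct σ (-μ) from rfl,
      ← map_weylOp_wtSpace hG₀ hX hw hlie (-μ), ← Submodule.map_sup]
    rfl
  -- Injectivity lets the image of the intersection be computed factor by factor.
  have hinj : Function.Injective ((weylOp M X w).restrictScalars ℝ) :=
    (weylOp_bijective hG₀ hX hw).1
  rw [realWtSpace, realWtSpace, Submodule.map_inf _ hinj, hsup, map_weylOp_range_realIncl hg]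

end Words

end WeylNil

end

/-! ### The action of the Weyl group by automorphisms and isometries -/

open WeylNil in
theorem proposition6p15 {G₀ U : Type*}
    [LieRing G₀] [LieAlgebra ℝ G₀] [FiniteDimensional ℝ G₀]
    [AddCommGroup U] [Module ℝ U] [FiniteDimensional ℝ U]
    [LieRingModule G₀ U] [LieModule ℝ G₀ U]
    (hG₀ : WeylNil.IsCompactSemisimple G₀)
    (H₀ : LieSubalgebra ℝ G₀) (hH₀ : Maximal (fun A : LieSubalgebra ℝ G₀ => IsLieAbelian A) H₀)
    (X : Module.Dual ℂ (WeylNil.cplx H₀) → ℂ ⊗[ℝ] G₀) (hX : WeylNil.IsAdapted H₀ X)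
    (σ : WeylNil.cplx H₀ ≃ₗ[ℂ] WeylNil.cplx H₀) (hσ : σ ∈ WeylNil.weylGroup (WeylNil.cplx H₀)) :
    (∃ w, WeylNil.IsWord w σ) ∧
    ∀ w, WeylNil.IsWord w σ →
      -- `T_σ` is invertible and `T_σ ∘ h ∘ T_σ⁻¹ = σ(h)` on `V` for `h` in `H`
      Function.Bijective (WeylNil.weylOp U X w) ∧
      (∀ (h : WeylNil.cplx H₀) (v : ℂ ⊗[ℝ] U),
        WeylNil.weylOp U X w ⁅(h : ℂ ⊗[ℝ] G₀), v⁆ =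
          ⁅(σ h : ℂ ⊗[ℝ] G₀), WeylNil.weylOp U X w v⁆) ∧
      -- `φ_σ` is an automorphism of `G` that extends `σ`
      (∃ f : (ℂ ⊗[ℝ] G₀) ≃ₗ⁅ℂ⁆ (ℂ ⊗[ℝ] G₀), ∀ y, f y = WeylNil.weylOp G₀ X w y) ∧
      (∀ h : WeylNil.cplx H₀, WeylNil.weylOp G₀ X w (h : ℂ ⊗[ℝ] G₀) = (σ h : ℂ ⊗[ℝ] G₀)) ∧
      -- `T_σ(V_μ) = V_{σ(μ)}` and `T_σ(U_μ) = U_{σ(μ)}`; both sides vanish if neither of `±μ` is a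
      -- weight
      (∀ μ, (WeylNil.wtSpace (ℂ ⊗[ℝ] U) (WeylNil.cplx H₀) μ).map (WeylNil.weylOp U X w) =
        WeylNil.wtSpace (ℂ ⊗[ℝ] U) (WeylNil.cplx H₀) (WeylNil.dualAct σ μ)) ∧
      (∀ μ, (WeylNil.realWtSpace (H₀ := H₀) U μ).map ((WeylNil.weylOp U X w).restrictScalars ℝ) =
        WeylNil.realWtSpace U (WeylNil.dualAct σ μ)) ∧
      -- `ζ_σ` is an automorphism of `N`, for every admissible form on `V ⊕ G`
      (∀ B : WeylNil.InvForm ℂ (ℂ ⊗[ℝ] G₀) (ℂ ⊗[ℝ] U),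
        ∃ e : WeylNil.TwoStep B ≃ₗ⁅ℂ⁆ WeylNil.TwoStep B,
          ∀ p, e (WeylNil.TwoStep.mk B p) = WeylNil.TwoStep.mk B (WeylNil.zeta U X w p)) ∧
      -- `ζ_σ` is unitary for every `G₀`-invariant Hermitian inner product on `N`, and so is `T_σ`
      -- on `V`
      (∀ h, WeylNil.IsInvHermitian
          (fun (x : G₀) (p : (ℂ ⊗[ℝ] U) × (ℂ ⊗[ℝ] G₀)) =>
            WeylNil.diagAct (WeylNil.realIncl G₀ x) p) h →
        ∀ p q, h (WeylNil.zeta U X w p) (WeylNil.zeta U X w q) = h p q) ∧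
      (∀ h, WeylNil.IsInvHermitian
          (fun (x : G₀) (v : ℂ ⊗[ℝ] U) => ⁅WeylNil.realIncl G₀ x, v⁆) h →
        ∀ v v', h (WeylNil.weylOp U X w v) (WeylNil.weylOp U X w v') = h v v') ∧
      -- `ζ_σ(N₀) = N₀`
      (LinearMap.range (WeylNil.realInclN G₀ U)).map ((WeylNil.zeta U X w).restrictScalars ℝ) =
        LinearMap.range (WeylNil.realInclN G₀ U) ∧
      -- the restriction `g` of `ζ_σ` to `N₀` is an automorphism of `N₀`, for every inner product that
      -- defines the bracket of `N₀`, and it is an isometry for every `G₀`-invariant inner product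
      ∃ g : (U × G₀) ≃ₗ[ℝ] (U × G₀),
        (∀ p, WeylNil.realInclN G₀ U (g p) = WeylNil.zeta U X w (WeylNil.realInclN G₀ U p)) ∧
        (∀ B₀ : WeylNil.InvForm ℝ G₀ U, B₀.IsPosDef →
          ∃ e₀ : WeylNil.TwoStep B₀ ≃ₗ⁅ℝ⁆ WeylNil.TwoStep B₀,
            ∀ p, e₀ (WeylNil.TwoStep.mk B₀ p) = WeylNil.TwoStep.mk B₀ (g p)) ∧
        (∀ b, WeylNil.IsInvInner (fun (x : G₀) (p : U × G₀) => WeylNil.diagAct x p) b →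
          ∀ p q, b (g p) (g q) = b p q) := by
  refine ⟨exists_isWord hG₀ hσ, ?_⟩
  rintro w ⟨hw, hprod⟩
  have hcoe : ∀ h : cplx H₀, weylOp G₀ X w (h : ℂ ⊗[ℝ] G₀) = (σ h : ℂ ⊗[ℝ] G₀) := fun h => by
    rw [weylOp_coe hG₀ hX hw, hprod]
    rfl
  have hlie : ∀ (h : cplx H₀) (v : ℂ ⊗[ℝ] U), weylOp U X w ⁅(h : ℂ ⊗[ℝ] G₀), v⁆ =
      ⁅(σ h : ℂ ⊗[ℝ] G₀), weylOp U X w v⁆ := fun h v => by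
    rw [weylOp_lie hG₀ hX hw, hcoe]
  let T : (ℂ ⊗[ℝ] U) ≃ₗ[ℂ] (ℂ ⊗[ℝ] U) := LinearEquiv.ofBijective _ (weylOp_bijective hG₀ hX hw)
  let φ : (ℂ ⊗[ℝ] G₀) ≃ₗ[ℂ] (ℂ ⊗[ℝ] G₀) :=
    LinearEquiv.ofBijective _ (weylOp_bijective hG₀ hX hw)
  obtain ⟨g, hg⟩ := exists_weylOp_realIncl (M := U) hG₀ hX hw
  obtain ⟨k, hk⟩ := exists_weylOp_realIncl (M := G₀) hG₀ hX hw
  have hgk : ∀ p : U × G₀, realInclN G₀ U (g.prodCongr k p) = zeta U X w (realInclN G₀ U p) :=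
    fun p => Prod.ext (hg p.1) (hk p.2)
  -- The compatibility of `T_σ` and `φ_σ` descends to the real forms because these embed in their
  -- complexifications.
  have hgklie : ∀ (y : G₀) (u : U), g ⁅y, u⁆ = ⁅k y, g u⁆ := fun y u => by
    apply realIncl_injective
    have hincl : ∀ (y : G₀) (u : U), realIncl U ⁅y, u⁆ = ⁅realIncl G₀ y, realIncl U u⁆ :=
      fun y u => by simp [realIncl]
    rw [hg, hincl, hincl, weylOp_lie hG₀ hX hw, hg, hk]
  refine ⟨weylOp_bijective hG₀ hX hw, hlie,
    ⟨{ φ with map_lie' := fun {y z} => weylOp_lie (M := G₀) hG₀ hX hw y z }, fun y => rfl⟩, hcoe,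
    map_weylOp_wtSpace hG₀ hX hw hlie, map_weylOp_realWtSpace hG₀ hX hw hlie, ?_,
    fun h hh => sesqPairing_zeta hG₀ hX hw h hh.skew,
    fun h hh => sesqPairing_weylOp hG₀ hX hw h hh.skew, ?_, g.prodCongr k, hgk, ?_,
    fun b hb => pairing_prodMap_of_realIncl_eq hG₀ hX hw b hb.skew hg hk⟩
  · intro B
    refine exists_twoStep_lieEquiv B T φ ?_ ?_ (weylOp_lie hG₀ hX hw)
    · exact bilinPairing_weylOp hG₀ hX hw B.formV B.skewV
    · exact bilinPairing_weylOp hG₀ hX hw B.formL B.skewL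
  · have e : (zeta U X w).restrictScalars ℝ ∘ₗ realInclN G₀ U =
        realInclN G₀ U ∘ₗ (g.prodCongr k : (U × G₀) →ₗ[ℝ] (U × G₀)) :=
      LinearMap.ext fun p => (hgk p).symm
    rw [← LinearMap.range_comp, e, LinearMap.range_comp_of_range_eq_top _ (LinearEquiv.range _)]
  · intro B₀ _
    exact exists_twoStep_lieEquiv B₀ g k
      (pairing_of_realIncl_eq hG₀ hX hw B₀.formV B₀.skewV hg hg)
      (pairing_of_realIncl_eq hG₀ hX hw B₀.formL B₀.skewL hk hk) hgklie
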